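/- Let $\alpha,\beta\in(0,1)$ and $\rho,\mu,\lambda>0$. Let $\{N_\beta(t,\lambda)\}_{t\ge 0}$ be a fractional Poisson process, i.e. the renewal counting process $N_\beta(t,\lambda)=\max\{n\ge 0: W_1+\dots+W_n\le t\}$ with independent waiting times $W_i$ satisfying $P(W_i>t)=\sum_{k=0}^\infty \frac{(-\lambda t^\beta)^k}{\Gamma(1+\beta k)}$ for $t\ge 0$. Let $\{M_{\alpha,\rho,\mu}(t)\}_{t\ge 0}$ be a Mittag-Leffler Lévy subordinator independent of $N_\beta$, i.e. a nondecreasing Lévy process started at $0$ with $\mathbb{E}\,e^{-uM_{\alpha,\rho,\mu}(t)}=\left(\frac{\mu}{\mu+u^\alpha}\right)^{\rho t}$ for $u,t\ge 0$. Then the generalized fractional negative binomial process $\mathcal{G}^{\mu,\beta}_{\alpha,\rho}(t,\lambda)=N_\beta(M_{\alpha,\rho,\mu}(t),\lambda)$, $t\ge 0$, is not infinitely divisible; that is, not all of its finite-dimensional distributions are infinitely divisible. -/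

import Mathlib

open MeasureTheory ProbabilityTheory
open scoped NNReal

noncomputable section

/-- The (one-parameter) Mittag-Leffler function `∑ zᵏ / Γ(1 + βk)`, for real argument. -/
def mittagLeffler (β z : ℝ) : ℝ :=
  ∑' k : ℕ, z ^ k / Real.Gamma (1 + β * k)

/-- `N` is a fractional Poisson process with index `β` and parameter `lam`: the renewal counting
process `N(t) = max {n ≥ 0 : W₀ + ⋯ + Wₙ₋₁ ≤ t}` whose waiting times `W₀, W₁, …` are
independent with the Mittag-Leffler survival function `P(Wᵢ > t) = E_β(-lam t^β)`. -/
structure IsFractionalPoissonProcess {Ω : Type*} [MeasurableSpace Ω] (P : Measure Ω)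
    (β lam : ℝ) (N : ℝ≥0 → Ω → ℕ) : Prop where
  measurable : ∀ t, Measurable (N t)
  renewal : ∃ W : ℕ → Ω → ℝ,
    (∀ i, Measurable (W i)) ∧
    iIndepFun W P ∧
    (∀ i, ∀ t : ℝ, 0 ≤ t → P.real {ω | t < W i ω} = mittagLeffler β (-lam * t ^ β)) ∧
    ∀ᵐ ω ∂P, ∀ (t : ℝ≥0) (n : ℕ), n ≤ N t ω ↔ ∑ i ∈ Finset.range n, W i ω ≤ (t : ℝ)

/-- `M` is a subordinator: a Lévy process with nondecreasing paths, with values in `[0, ∞)`.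
(The subtraction of `ℝ≥0` in the increments is the true one almost surely, by monotonicity.) -/
structure IsSubordinator {Ω : Type*} [MeasurableSpace Ω] (P : Measure Ω)
    (M : ℝ≥0 → Ω → ℝ≥0) : Prop where
  measurable : ∀ t, Measurable (M t)
  start : ∀ᵐ ω ∂P, M 0 ω = 0
  mono : ∀ᵐ ω ∂P, Monotone fun t => M t ω
  rightCts : ∀ᵐ ω ∂P, ∀ t, ContinuousWithinAt (fun s => M s ω) (Set.Ici t) t
  indep : HasIndepIncrements M P
  stationary : ∀ s h, IdentDistrib (fun ω => M (s + h) ω - M s ω) (M h) P P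

/-- `M` is a Mittag-Leffler Lévy subordinator with parameters `α`, `ρ`, `μ`: a subordinator with
Laplace transform `E exp(-u M(t)) = (μ / (μ + u^α))^(ρ t)`. -/
structure IsMittagLefflerSubordinator {Ω : Type*} [MeasurableSpace Ω] (P : Measure Ω)
    (α ρ μ : ℝ) (M : ℝ≥0 → Ω → ℝ≥0) : Prop extends IsSubordinator P M where
  laplace : ∀ (t : ℝ≥0) (u : ℝ), 0 ≤ u →
    ∫ ω, Real.exp (-u * (M t ω : ℝ)) ∂P = (μ / (μ + u ^ α)) ^ (ρ * (t : ℝ))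

/-- `N` and `M` are the two ingredients of a generalized fractional negative binomial process:
a fractional Poisson process and an independent Mittag-Leffler Lévy subordinator. -/
structure IsGFNBPPair {Ω : Type*} [MeasurableSpace Ω] (P : Measure Ω)
    (α β ρ μ lam : ℝ) (N : ℝ≥0 → Ω → ℕ) (M : ℝ≥0 → Ω → ℝ≥0) : Prop where
  poisson : IsFractionalPoissonProcess P β lam N
  subordinator : IsMittagLefflerSubordinator P α ρ μ M
  indep : IndepFun (fun ω t => N t ω) (fun ω t => M t ω) P

/-- The time-changed process `t ↦ N(M(t))`, as a real-valued process. -/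
def timeChange {Ω : Type*} (N : ℝ≥0 → Ω → ℕ) (M : ℝ≥0 → Ω → ℝ≥0) (t : ℝ≥0) (ω : Ω) : ℝ :=
  (N (M t ω) ω : ℝ)

/-- A probability distribution is infinitely divisible if for every `n ≥ 1` it is the distribution
of a sum of `n` independent, identically distributed random vectors. -/
def IsInfinitelyDivisible {E : Type*} [AddCommMonoid E] [MeasurableSpace E] (ν : Measure E) :
    Prop :=
  ∀ n : ℕ, 1 ≤ n → ∃ η : Measure E, IsProbabilityMeasure η ∧
    (Measure.pi fun _ : Fin n => η).map (fun x => ∑ i, x i) = ν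

/-- A real-valued process is infinitely divisible if all its finite-dimensional distributions
are. -/
def IsInfinitelyDivisibleProcess {Ω T : Type*} [MeasurableSpace Ω] (P : Measure Ω)
    (X : T → Ω → ℝ) : Prop :=
  ∀ I : Finset T, IsInfinitelyDivisible (P.map fun ω (i : I) => X i ω)

end

theorem ae_nonneg_of_map_sum_pi {E : Type*} [AddCommMonoid E] [MeasurableSpace E]
    {n : ℕ} (hn : 1 ≤ n) (η : Measure E) [IsProbabilityMeasure η]
    (a : E →+ ℝ)
    (h : ∀ᵐ x ∂(Measure.pi fun _ : Fin n => η), 0 ≤ a (∑ i, x i)) :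
    ∀ᵐ x ∂η, 0 ≤ a x := by
  have hsub : (Set.univ.pi fun _ : Fin n => {x | a x < 0}) ⊆ {x | ¬ 0 ≤ a (∑ i, x i)} := by
    intro x hx
    have hx' : ∀ i, a (x i) < 0 := fun i => hx i (Set.mem_univ i)
    simp only [Set.mem_ofPred_eq, not_le, map_sum]
    have : Nonempty (Fin n) := ⟨⟨0, hn⟩⟩
    exact Finset.sum_neg (fun i _ => hx' i) Finset.univ_nonempty
  have h0 := measure_mono_null hsub h
  rw [Measure.pi_pi] at h0
  simp only [Finset.prod_const, Finset.card_univ, Fintype.card_fin] at h0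
  have h1 : η {x | a x < 0} = 0 := eq_zero_of_pow_eq_zero h0
  rw [ae_iff]
  simpa using h1

theorem pi_sum_eq_zero {E : Type*} [AddCommMonoid E] [MeasurableSpace E]
    {n : ℕ} (η : Measure E) [IsProbabilityMeasure η] {J : Type*} [Finite J]
    (a : J → E →+ ℝ) (ha : ∀ j, ∀ᵐ x ∂η, 0 ≤ a j x) :
    (Measure.pi fun _ : Fin n => η) {x | ∀ j, a j (∑ i, x i) = 0} = η {x | ∀ j, a j x = 0} ^ n := by
  have h1 : (Measure.pi fun _ : Fin n => η) {x | ∀ j, a j (∑ i, x i) = 0}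
      = (Measure.pi fun _ : Fin n => η) (Set.univ.pi fun _ : Fin n => {x | ∀ j, a j x = 0}) := by
    apply measure_congr
    have h2 : ∀ᵐ x ∂(Measure.pi fun _ : Fin n => η), ∀ i j, 0 ≤ a j (x i) := by
      rw [ae_all_iff]
      intro i
      rw [ae_all_iff]
      intro j
      exact (measurePreserving_eval (fun _ : Fin n => η) i).quasiMeasurePreserving.ae (ha j)
    filter_upwards [h2] with x hx
    apply propext
    change (∀ j, a j (∑ i, x i) = 0) ↔ ∀ i ∈ Set.univ, ∀ j, a j (x i) = 0
    simp only [map_sum, Set.mem_univ, true_implies]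
    rw [forall_comm (α := Fin n)]
    refine forall_congr' fun j => ?_
    rw [Finset.sum_eq_zero_iff_of_nonneg (fun i _ => hx i j)]
    simp
  rw [h1, Measure.pi_pi]
  simp

theorem mul_le_of_root_le {x y z : ℝ} (hx : 0 ≤ x) (hy : 0 ≤ y) (hz : 0 ≤ z)
    (h : ∀ n : ℕ, 1 ≤ n → ∃ p q r : ℝ, 0 ≤ p ∧ 0 ≤ q ∧ 0 ≤ r ∧ p ^ n = x ∧ q ^ n = y ∧ r ^ n = z ∧
      p + q - 1 ≤ r) : x * y ≤ z := by
  rcases hx.eq_or_lt with rfl | hx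
  · simpa using hz
  rcases hy.eq_or_lt with rfl | hy
  · simpa using hz
  have hlim := Real.tendsto_one_add_div_pow_exp (Real.log x + Real.log y)
  rw [Real.exp_add, Real.exp_log hx, Real.exp_log hy] at hlim
  refine le_of_tendsto hlim ?_
  have hev : ∀ᶠ n : ℕ in Filter.atTop, 0 ≤ 1 + (Real.log x + Real.log y) / n := by
    have : Filter.Tendsto (fun n : ℕ => 1 + (Real.log x + Real.log y) / (n : ℝ)) Filter.atTop
        (nhds (1 + 0)) :=
      tendsto_const_nhds.add (tendsto_const_div_atTop_nhds_zero_nat _)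
    exact (this.eventually (lt_mem_nhds (by norm_num : (0 : ℝ) < 1 + 0))).mono fun _ h => h.le
  filter_upwards [hev, Filter.eventually_ge_atTop 1] with n hn0 hn
  obtain ⟨p, q, r, hp, hq, hr, rfl, rfl, rfl, hpqr⟩ := h n hn
  have hn' : (n : ℝ) ≠ 0 := by positivity
  have hp' : 0 < p := lt_of_le_of_ne hp (by rintro rfl; simp [show n ≠ 0 by omega] at hx)
  have hq' : 0 < q := lt_of_le_of_ne hq (by rintro rfl; simp [show n ≠ 0 by omega] at hy)
  refine pow_le_pow_left₀ hn0 ?_ n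
  rw [Real.log_pow, Real.log_pow, ← mul_add, mul_div_cancel_left₀ _ hn']
  linarith [Real.log_le_sub_one_of_pos hp', Real.log_le_sub_one_of_pos hq']

/-- Two nonnegative additive functionals of an infinitely divisible vector vanish together with at
least the probability they would have if they were independent. -/
theorem IsInfinitelyDivisible.mul_le_measureReal {E : Type*} [AddCommMonoid E] [MeasurableSpace E]
    [MeasurableAdd₂ E] {ν : Measure E} (hν : IsInfinitelyDivisible ν)
    (a b : E →+ ℝ) (ha : Measurable a) (hb : Measurable b)
    (ha0 : ∀ᵐ x ∂ν, 0 ≤ a x) (hb0 : ∀ᵐ x ∂ν, 0 ≤ b x) :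
    ν.real {x | a x = 0} * ν.real {x | b x = 0} ≤ ν.real {x | a x = 0 ∧ b x = 0} := by
  refine mul_le_of_root_le measureReal_nonneg measureReal_nonneg measureReal_nonneg ?_
  intro n hn
  obtain ⟨η, hη, hmap⟩ := hν n hn
  have hS : Measurable fun x : Fin n → E => ∑ i, x i :=
    Finset.measurable_fun_sum _ fun i _ => measurable_pi_apply i
  have hA : ∀ᵐ x ∂η, 0 ≤ a x :=
    ae_nonneg_of_map_sum_pi hn η a (ae_of_ae_map hS.aemeasurable (hmap ▸ ha0))
  have hB : ∀ᵐ x ∂η, 0 ≤ b x :=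
    ae_nonneg_of_map_sum_pi hn η b (ae_of_ae_map hS.aemeasurable (hmap ▸ hb0))
  have hma : MeasurableSet {x | a x = 0} := ha (measurableSet_singleton 0)
  have hmb : MeasurableSet {x | b x = 0} := hb (measurableSet_singleton 0)
  have e1 : ν {x | a x = 0} = η {x | a x = 0} ^ n := by
    have := pi_sum_eq_zero (n := n) η (fun _ : Unit => a) (fun _ => hA)
    rw [← hmap, Measure.map_apply hS hma]
    simpa using this
  have e2 : ν {x | b x = 0} = η {x | b x = 0} ^ n := by
    have := pi_sum_eq_zero (n := n) η (fun _ : Unit => b) (fun _ => hB)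
    rw [← hmap, Measure.map_apply hS hmb]
    simpa using this
  have e3 : ν {x | a x = 0 ∧ b x = 0} = η {x | a x = 0 ∧ b x = 0} ^ n := by
    have := pi_sum_eq_zero (n := n) η (fun j : Bool => if j then a else b)
      (by rintro (_ | _) <;> simpa)
    have hm : MeasurableSet {x | a x = 0 ∧ b x = 0} := hma.inter hmb
    rw [← hmap, Measure.map_apply hS hm]
    simpa [and_comm] using this
  refine ⟨η.real {x | a x = 0}, η.real {x | b x = 0}, η.real {x | a x = 0 ∧ b x = 0},
    measureReal_nonneg, measureReal_nonneg, measureReal_nonneg, ?_, ?_, ?_, ?_⟩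
  · simp [Measure.real, e1]
  · simp [Measure.real, e2]
  · simp [Measure.real, e3]
  · have h1 := measureReal_union_add_inter (μ := η) (s := {x | a x = 0}) hmb
    have h2 : η.real ({x | a x = 0} ∪ {x | b x = 0}) ≤ 1 := measureReal_le_one
    have h3 : {x | a x = 0} ∩ {x | b x = 0} = {x | a x = 0 ∧ b x = 0} := rfl
    rw [h3] at h1
    linarith

theorem Real.Gamma_div_Gamma_add_le {β y : ℝ} (hβ₀ : 0 < β) (hβ₁ : β < 1) (hy : 1 ≤ y) :
    Real.Gamma y / Real.Gamma (y + β) ≤ 2 ^ (1 - β) * y ^ (-β) := by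
  have hy0 : 0 < y := by linarith
  have hg : 0 < Real.Gamma (y + β) := Real.Gamma_pos_of_pos (by linarith)
  have h1 := Real.Gamma_mul_add_mul_le_rpow_Gamma_mul_rpow_Gamma (s := y + β) (t := y + β + 1)
    (a := β) (b := 1 - β) (by linarith) (by linarith) hβ₀ (by linarith) (by ring)
  rw [show β * (y + β) + (1 - β) * (y + β + 1) = y + 1 by ring, Real.Gamma_add_one hy0.ne',
    Real.Gamma_add_one (by positivity), Real.mul_rpow (by positivity) hg.le, mul_left_comm,
    ← Real.rpow_add hg, show β + (1 - β) = 1 by ring, Real.rpow_one] at h1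
  have h2 : (y + β) ^ (1 - β) ≤ (2 * y) ^ (1 - β) :=
    Real.rpow_le_rpow (by positivity) (by linarith) (by linarith)
  rw [Real.mul_rpow (by norm_num) hy0.le, sub_eq_add_neg, Real.rpow_add hy0, Real.rpow_one,
    ← sub_eq_add_neg] at h2
  rw [div_le_iff₀ hg]
  have h3 : y * Real.Gamma y ≤ y * (2 ^ (1 - β) * y ^ (-β) * Real.Gamma (y + β)) := by
    calc _ ≤ _ := h1
      _ ≤ (2 ^ (1 - β) * (y * y ^ (-β))) * Real.Gamma (y + β) := by gcongr
      _ = _ := by ring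
  exact le_of_mul_le_mul_left h3 hy0

theorem summable_pow_div_Gamma {β : ℝ} (hβ₀ : 0 < β) (hβ₁ : β < 1) (z : ℝ) :
    Summable fun k : ℕ => z ^ k / Real.Gamma (1 + β * k) := by
  rcases eq_or_ne z 0 with rfl | hz
  · exact summable_of_ne_finset_zero (s := {0}) fun k hk => by simp_all
  have hΓ : ∀ k : ℕ, 0 < Real.Gamma (1 + β * k) := fun k => Real.Gamma_pos_of_pos (by positivity)
  refine summable_of_ratio_test_tendsto_lt_one (l := 0) one_pos
    (Filter.Eventually.of_forall fun k => div_ne_zero (pow_ne_zero k hz) (hΓ k).ne') ?_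
  have hbound : ∀ k : ℕ, ‖z ^ (k + 1) / Real.Gamma (1 + β * (k + 1 : ℕ))‖ /
      ‖z ^ k / Real.Gamma (1 + β * k)‖ ≤ |z| * (2 ^ (1 - β) * (1 + β * k) ^ (-β)) := by
    intro k
    have := Real.Gamma_div_Gamma_add_le hβ₀ hβ₁ (y := 1 + β * k)
      (by have : 0 ≤ β * k := by positivity
          linarith)
    have e : (1 + β * (k + 1 : ℕ) : ℝ) = 1 + β * k + β := by push_cast; ring
    rw [norm_div, norm_div, norm_pow, norm_pow, Real.norm_eq_abs, Real.norm_of_nonneg (hΓ _).le,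
      Real.norm_of_nonneg (hΓ _).le, e]
    have hz' : |z| ≠ 0 := abs_ne_zero.2 hz
    calc _ = |z| * (Real.Gamma (1 + β * k) / Real.Gamma (1 + β * k + β)) := by
          have := hΓ (k + 1)
          rw [e] at this
          have := hΓ k
          rw [pow_succ]
          field_simp
      _ ≤ _ := by gcongr
  refine squeeze_zero (fun k => by positivity) hbound ?_
  have h1 : Filter.Tendsto (fun k : ℕ => (1 + β * k : ℝ)) Filter.atTop Filter.atTop :=
    Filter.tendsto_atTop_add_const_left _ _
      (tendsto_natCast_atTop_atTop.const_mul_atTop hβ₀)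
  have h2 := (tendsto_rpow_neg_atTop hβ₀).comp h1
  simpa using (h2.const_mul (2 ^ (1 - β))).const_mul |z|

theorem integral_rpow_mul_sub_rpow {a b t : ℝ} (ha : 0 < a) (hb : 0 < b) (ht : 0 < t) :
    IntervalIntegrable (fun v => v ^ (a - 1) * (t - v) ^ (b - 1)) volume 0 t ∧
    ∫ v in 0..t, v ^ (a - 1) * (t - v) ^ (b - 1) =
      t ^ (a + b - 1) * (Real.Gamma a * Real.Gamma b / Real.Gamma (a + b)) := by
  have hcongr : ∀ v ∈ Set.Ioc 0 t,
      ((v : ℂ) ^ ((a : ℂ) - 1) * ((t : ℂ) - v) ^ ((b : ℂ) - 1)) =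
        ((v ^ (a - 1) * (t - v) ^ (b - 1) : ℝ) : ℂ) := by
    intro v hv
    have h1 : 0 ≤ t - v := by linarith [hv.2]
    push_cast
    rw [Complex.ofReal_cpow hv.1.le, Complex.ofReal_cpow h1]
    push_cast
    rfl
  have hval := Complex.betaIntegral_scaled (a : ℂ) (b : ℂ) ht
  have heq : (∫ x in (0 : ℝ)..t, ((x : ℂ) ^ ((a : ℂ) - 1) * ((t : ℂ) - x) ^ ((b : ℂ) - 1))) =
      ((∫ v in (0 : ℝ)..t, v ^ (a - 1) * (t - v) ^ (b - 1) : ℝ) : ℂ) := by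
    rw [← intervalIntegral.integral_ofReal]
    refine intervalIntegral.integral_congr_ae (Filter.Eventually.of_forall fun v hv => ?_)
    rw [Set.uIoc_of_le ht.le] at hv
    exact hcongr v hv
  have hreal : ∫ v in 0..t, v ^ (a - 1) * (t - v) ^ (b - 1) =
      t ^ (a + b - 1) * (Real.Gamma a * Real.Gamma b / Real.Gamma (a + b)) := by
    have h := heq.symm.trans hval
    rw [Complex.betaIntegral_eq_Gamma_mul_div _ _ (by simpa) (by simpa)] at h
    have e : ((t : ℂ) ^ ((a : ℂ) + b - 1)) = ((t ^ (a + b - 1) : ℝ) : ℂ) := by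
      rw [Complex.ofReal_cpow ht.le]; push_cast; rfl
    rw [e, Complex.Gamma_ofReal, Complex.Gamma_ofReal, ← Complex.ofReal_add,
      Complex.Gamma_ofReal] at h
    exact_mod_cast h
  refine ⟨?_, hreal⟩
  by_contra hni
  rw [intervalIntegral.integral_undef hni] at hreal
  have h1 := Real.Gamma_pos_of_pos ha
  have h2 := Real.Gamma_pos_of_pos hb
  have h3 := Real.Gamma_pos_of_pos (add_pos ha hb)
  have : 0 < t ^ (a + b - 1) * (Real.Gamma a * Real.Gamma b / Real.Gamma (a + b)) := by positivity
  linarith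

theorem mittagLeffler_zero (β : ℝ) : mittagLeffler β 0 = 1 := by
  unfold mittagLeffler
  rw [tsum_eq_single 0]
  · simp
  · intro k hk
    simp [hk]

/-- The Volterra equation of the Mittag-Leffler survival function. -/
theorem integral_rpow_mul_mittagLeffler {β lam t : ℝ} (hβ₀ : 0 < β) (hβ₁ : β < 1)
    (hlam : 0 < lam) (ht : 0 < t) :
    ∫ v in 0..t, lam / Real.Gamma β * v ^ (β - 1) * mittagLeffler β (-lam * (t - v) ^ β) =
      1 - mittagLeffler β (-lam * t ^ β) := by
  have hΓβ := Real.Gamma_pos_of_pos hβ₀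
  have hΓ : ∀ k : ℕ, 0 < Real.Gamma (1 + β * k) := fun k => Real.Gamma_pos_of_pos (by positivity)
  let F : ℕ → ℝ → ℝ := fun k v => (lam / Real.Gamma β * ((-lam) ^ k / Real.Gamma (1 + β * k))) *
    (v ^ (β - 1) * (t - v) ^ (1 + β * k - 1))
  have hI := fun k : ℕ => integral_rpow_mul_sub_rpow (a := β) (b := 1 + β * k) hβ₀
    (by positivity) ht
  have hFint : ∀ k, IntegrableOn (F k) (Set.Ioc 0 t) := fun k => by
    rw [← intervalIntegrable_iff_integrableOn_Ioc_of_le ht.le]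
    exact (hI k).1.const_mul _
  have hFval : ∀ k, ∫ v in Set.Ioc 0 t, F k v =
      -((-lam * t ^ β) ^ (k + 1) / Real.Gamma (1 + β * (k + 1 : ℕ))) := by
    intro k
    rw [← intervalIntegral.integral_of_le ht.le, intervalIntegral.integral_const_mul, (hI k).2]
    have e1 : t ^ (β + (1 + β * k) - 1) = (t ^ β) ^ (k + 1) := by
      rw [← Real.rpow_natCast, ← Real.rpow_mul ht.le]
      congr 1; push_cast; ring
    have e2 : (1 + β * (k + 1 : ℕ) : ℝ) = β + (1 + β * k) := by push_cast; ring
    have := hΓ (k + 1)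
    rw [e2] at this
    have := hΓ k
    rw [e1, e2, mul_pow, pow_succ (-lam) k]
    field_simp
  have hFnorm : ∀ k, ∫ v in Set.Ioc 0 t, ‖F k v‖ =
      (lam * t ^ β) ^ (k + 1) / Real.Gamma (1 + β * (k + 1 : ℕ)) := by
    intro k
    have h1 : ∀ v ∈ Set.Ioc 0 t, ‖F k v‖ = (-1) ^ k * F k v := by
      intro v hv
      have a1 : 0 ≤ v ^ (β - 1) := Real.rpow_nonneg hv.1.le _
      have a2 : 0 ≤ (t - v) ^ (1 + β * k - 1) := Real.rpow_nonneg (by linarith [hv.2]) _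
      have a3 := hΓ k
      have : (-1) ^ k * F k v = lam / Real.Gamma β * (lam ^ k / Real.Gamma (1 + β * k)) *
          (v ^ (β - 1) * (t - v) ^ (1 + β * k - 1)) := by
        simp only [F]
        rw [neg_pow lam k]
        have : ((-1 : ℝ) ^ k) * (-1) ^ k = 1 := by rw [← mul_pow]; simp
        linear_combination (lam / Real.Gamma β * (lam ^ k / Real.Gamma (1 + β * k)) *
          (v ^ (β - 1) * (t - v) ^ (1 + β * k - 1))) * this
      have h0 : 0 ≤ (-1) ^ k * F k v := by rw [this]; positivity
      rw [← Real.norm_of_nonneg h0]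
      simp
    rw [setIntegral_congr_fun measurableSet_Ioc h1, integral_const_mul, hFval, neg_mul,
      neg_pow (lam * t ^ β)]
    have : ((-1 : ℝ) ^ k) * (-1) ^ k = 1 := by rw [← mul_pow]; simp
    rw [pow_succ (-1 : ℝ)]
    linear_combination (lam * t ^ β) ^ (k + 1) / Real.Gamma (1 + β * (k + 1 : ℕ)) * this
  have hsum : Summable fun k => ∫ v in Set.Ioc 0 t, ‖F k v‖ := by
    simp_rw [hFnorm]
    exact (summable_nat_add_iff 1).2 (summable_pow_div_Gamma hβ₀ hβ₁ (lam * t ^ β))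
  have hHas := hasSum_integral_of_summable_integral_norm hFint hsum
  have htsum : ∀ v ∈ Set.Ioc 0 t, ∑' k, F k v =
      lam / Real.Gamma β * v ^ (β - 1) * mittagLeffler β (-lam * (t - v) ^ β) := by
    intro v hv
    unfold mittagLeffler
    rw [← tsum_mul_left]
    congr 1
    ext k
    simp only [F]
    have : (t - v) ^ (1 + β * k - 1) = ((t - v) ^ β) ^ k := by
      rw [← Real.rpow_natCast, ← Real.rpow_mul (by linarith [hv.2])]
      congr 1; ring
    rw [this, mul_pow]
    ring
  rw [intervalIntegral.integral_of_le ht.le, ← setIntegral_congr_fun measurableSet_Ioc htsum,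
    ← hHas.tsum_eq]
  simp_rw [hFval]
  rw [tsum_neg]
  have := (summable_pow_div_Gamma hβ₀ hβ₁ (-lam * t ^ β)).tsum_eq_zero_add
  simp only [pow_zero, Nat.cast_zero, mul_zero, add_zero, Real.Gamma_one, div_one] at this
  rw [mittagLeffler, this]
  ring

/-- The density of the renewal measure of the fractional Poisson process. -/
noncomputable def renewalDensity (β lam v : ℝ) : ENNReal :=
  (Set.Ioi (0 : ℝ)).indicator (fun v => ENNReal.ofReal (lam / Real.Gamma β * v ^ (β - 1))) v

/-- The renewal measure of the fractional Poisson process. -/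
noncomputable def renewalMeasure (β lam : ℝ) : Measure ℝ :=
  volume.withDensity (renewalDensity β lam)

/-- `ω` is the waiting time distribution of the fractional Poisson process. -/
structure IsMittagLefflerLaw (β lam : ℝ) (ω : Measure ℝ) : Prop where
  isProb : IsProbabilityMeasure ω
  survival : ∀ t : ℝ, 0 ≤ t → ω.real (Set.Ioi t) = mittagLeffler β (-lam * t ^ β)

@[fun_prop]
theorem measurable_renewalDensity (β lam : ℝ) : Measurable (renewalDensity β lam) := by
  unfold renewalDensity
  exact Measurable.indicator (by fun_prop) measurableSet_Ioi

theorem renewalDensity_of_pos {β lam v : ℝ} (hv : 0 < v) :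
    renewalDensity β lam v = ENNReal.ofReal (lam / Real.Gamma β * v ^ (β - 1)) := by
  simp [renewalDensity, hv]

theorem renewalDensity_of_nonpos {β lam v : ℝ} (hv : v ≤ 0) : renewalDensity β lam v = 0 := by
  simp [renewalDensity, hv]

theorem measurable_measure_Ioi (ω : Measure ℝ) : Measurable fun x => ω (Set.Ioi x) :=
  Antitone.measurable fun _ _ h => measure_mono (Set.Ioi_subset_Ioi h)

theorem measurable_measure_Iic (ω : Measure ℝ) : Measurable fun x => ω (Set.Iic x) :=
  Monotone.measurable fun _ _ h => measure_mono (Set.Iic_subset_Iic.2 h)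

theorem integral_rpow_sub_one {β lam t : ℝ} (hβ₀ : 0 < β) (hlam : 0 < lam) (ht : 0 ≤ t) :
    IntegrableOn (fun v => lam / Real.Gamma β * v ^ (β - 1)) (Set.Ioc 0 t) ∧
    ∫⁻ v in Set.Ioc 0 t, renewalDensity β lam v =
      ENNReal.ofReal (lam / Real.Gamma (β + 1) * t ^ β) := by
  have hΓβ := Real.Gamma_pos_of_pos hβ₀
  have h1 : IntegrableOn (fun v => lam / Real.Gamma β * v ^ (β - 1)) (Set.Ioc 0 t) := by
    rw [← intervalIntegrable_iff_integrableOn_Ioc_of_le ht]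
    exact (intervalIntegral.intervalIntegrable_rpow' (by linarith)).const_mul _
  refine ⟨h1, ?_⟩
  rw [setLIntegral_congr_fun measurableSet_Ioc (fun v hv => renewalDensity_of_pos hv.1),
    ← ofReal_integral_eq_lintegral_ofReal h1, ← intervalIntegral.integral_of_le ht,
    intervalIntegral.integral_const_mul, integral_rpow (Or.inl (by linarith)),
    Real.Gamma_add_one hβ₀.ne']
  · congr 1
    rw [sub_add_cancel, Real.zero_rpow hβ₀.ne']
    field_simp
    ring
  · refine (ae_restrict_iff' measurableSet_Ioc).2 (Filter.Eventually.of_forall fun v hv => ?_)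
    have := Real.rpow_nonneg hv.1.le (β - 1)
    simp only [Pi.zero_apply]
    positivity

namespace IsMittagLefflerLaw

variable {β lam : ℝ} {ω : Measure ℝ}

theorem measure_Iic_of_nonpos (h : IsMittagLefflerLaw β lam ω) (hβ₀ : 0 < β) {t : ℝ}
    (ht : t ≤ 0) : ω (Set.Iic t) = 0 := by
  have := h.isProb
  refine measure_mono_null (Set.Iic_subset_Iic.2 ht) ?_
  have h1 := h.survival 0 le_rfl
  rw [Real.zero_rpow hβ₀.ne', mul_zero, mittagLeffler_zero] at h1
  have h2 := probReal_compl_eq_one_sub (μ := ω) (measurableSet_Ioi (a := (0 : ℝ)))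
  rw [h1, Set.compl_Ioi, sub_self, measureReal_eq_zero_iff] at h2
  exact h2

/-- Decomposition of the distribution function at the last renewal. -/
theorem measure_Iic_eq (h : IsMittagLefflerLaw β lam ω) (hβ₀ : 0 < β) (hβ₁ : β < 1)
    (hlam : 0 < lam) {t : ℝ} (ht : 0 ≤ t) :
    ω (Set.Iic t) = ∫⁻ r in Set.Ioc 0 t, renewalDensity β lam r * ω (Set.Ioi (t - r)) := by
  have := h.isProb
  have hΓβ := Real.Gamma_pos_of_pos hβ₀
  rcases ht.eq_or_lt with rfl | ht'
  · simp [h.measure_Iic_of_nonpos hβ₀ le_rfl]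
  have h1 : ∀ r ∈ Set.Ioc 0 t, renewalDensity β lam r * ω (Set.Ioi (t - r)) =
      ENNReal.ofReal (lam / Real.Gamma β * r ^ (β - 1) * ω.real (Set.Ioi (t - r))) := by
    intro r hr
    have := Real.rpow_nonneg hr.1.le (β - 1)
    rw [renewalDensity_of_pos hr.1, ENNReal.ofReal_mul (p := lam / Real.Gamma β * r ^ (β - 1))
      (by positivity), ofReal_measureReal]
  have hmeas : Measurable fun r => ω.real (Set.Ioi (t - r)) :=
    ((measurable_measure_Ioi ω).comp (measurable_const.sub measurable_id)).ennreal_toReal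
  have h2 : IntegrableOn (fun r => lam / Real.Gamma β * r ^ (β - 1) * ω.real (Set.Ioi (t - r)))
      (Set.Ioc 0 t) := by
    refine (integral_rpow_sub_one hβ₀ hlam ht).1.mul_bdd (c := 1) hmeas.aestronglyMeasurable ?_
    exact Filter.Eventually.of_forall fun r => by
      rw [Real.norm_of_nonneg measureReal_nonneg]
      exact measureReal_le_one
  have h3 : ∫ r in Set.Ioc 0 t, lam / Real.Gamma β * r ^ (β - 1) * ω.real (Set.Ioi (t - r)) =
      1 - mittagLeffler β (-lam * t ^ β) := by
    rw [← integral_rpow_mul_mittagLeffler hβ₀ hβ₁ hlam ht', intervalIntegral.integral_of_le ht]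
    refine setIntegral_congr_fun measurableSet_Ioc fun r hr => ?_
    rw [h.survival _ (by linarith [hr.2])]
  rw [setLIntegral_congr_fun measurableSet_Ioc h1, ← ofReal_integral_eq_lintegral_ofReal h2, h3,
    ← h.survival t ht, ← probReal_compl_eq_one_sub measurableSet_Ioi, Set.compl_Ioi,
    ofReal_measureReal]
  refine (ae_restrict_iff' measurableSet_Ioc).2 (Filter.Eventually.of_forall fun v hv => ?_)
  have := Real.rpow_nonneg hv.1.le (β - 1)
  simp only [Pi.zero_apply]
  positivity

theorem measure_Iic_le (h : IsMittagLefflerLaw β lam ω) (hβ₀ : 0 < β) (hβ₁ : β < 1)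
    (hlam : 0 < lam) {t : ℝ} (ht : 0 ≤ t) :
    ω (Set.Iic t) ≤ ENNReal.ofReal (lam / Real.Gamma (β + 1) * t ^ β) := by
  have := h.isProb
  rw [h.measure_Iic_eq hβ₀ hβ₁ hlam ht, ← (integral_rpow_sub_one hβ₀ hlam ht).2]
  exact lintegral_mono fun r => mul_le_of_le_one_right' prob_le_one

theorem measure_Iic_pos (h : IsMittagLefflerLaw β lam ω) (hβ₀ : 0 < β) (hβ₁ : β < 1)
    (hlam : 0 < lam) {t : ℝ} (ht : 0 < t) : 0 < ω (Set.Iic t) := by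
  have := h.isProb
  rw [pos_iff_ne_zero]
  intro h0
  have h1 : ∀ r ∈ Set.Ioc 0 t, renewalDensity β lam r * ω (Set.Ioi (t - r)) =
      renewalDensity β lam r := by
    intro r hr
    have : ω (Set.Iic (t - r)) = 0 :=
      measure_mono_null (Set.Iic_subset_Iic.2 (by linarith [hr.1])) h0
    rw [← Set.compl_Iic, prob_compl_eq_one_sub measurableSet_Iic, this]
    simp
  rw [h.measure_Iic_eq hβ₀ hβ₁ hlam ht.le, setLIntegral_congr_fun measurableSet_Ioc h1,
    (integral_rpow_sub_one hβ₀ hlam ht.le).2, ENNReal.ofReal_eq_zero] at h0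
  have : 0 < lam / Real.Gamma (β + 1) * t ^ β := by
    have := Real.Gamma_pos_of_pos (show 0 < β + 1 by linarith)
    have := Real.rpow_pos_of_pos ht β
    positivity
  linarith

theorem renewalMeasure_Iic (hβ₀ : 0 < β) (hlam : 0 < lam) (t : ℝ) :
    renewalMeasure β lam (Set.Iic t) = ENNReal.ofReal (lam / Real.Gamma (β + 1) * (max t 0) ^ β) := by
  rw [← (integral_rpow_sub_one hβ₀ hlam (le_max_right t 0)).2, renewalMeasure,
    withDensity_apply _ measurableSet_Iic]
  rw [← lintegral_indicator measurableSet_Iic, ← lintegral_indicator measurableSet_Ioc]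
  congr 1
  ext v
  by_cases hv : 0 < v
  · have : v ∈ Set.Iic t ↔ v ∈ Set.Ioc 0 (max t 0) := by
      simp only [Set.mem_Iic, Set.mem_Ioc, le_max_iff]
      constructor
      · intro h; exact ⟨hv, Or.inl h⟩
      · rintro ⟨_, h | h⟩
        · exact h
        · linarith
    by_cases hm : v ∈ Set.Iic t
    · rw [Set.indicator_of_mem hm, Set.indicator_of_mem (this.1 hm)]
    · rw [Set.indicator_of_notMem hm, Set.indicator_of_notMem (fun hc => hm (this.2 hc))]
  · simp [Set.indicator, renewalDensity_of_nonpos (not_lt.1 hv)]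

theorem isLocallyFiniteMeasure_renewalMeasure (hβ₀ : 0 < β) (hlam : 0 < lam) :
    IsLocallyFiniteMeasure (renewalMeasure β lam) :=
  ⟨fun x => ⟨Set.Iic (x + 1), Iic_mem_nhds (by linarith), by
    rw [renewalMeasure_Iic hβ₀ hlam]; exact ENNReal.ofReal_lt_top⟩⟩

/-- The renewal equation. -/
theorem renewalMeasure_eq (h : IsMittagLefflerLaw β lam ω) (hβ₀ : 0 < β) (hβ₁ : β < 1)
    (hlam : 0 < lam) :
    renewalMeasure β lam = ω + Measure.conv ω (renewalMeasure β lam) := by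
  have := h.isProb
  have := isLocallyFiniteMeasure_renewalMeasure hβ₀ hlam
  have hIic : ∀ t, renewalMeasure β lam (Set.Iic t) =
      (ω + Measure.conv ω (renewalMeasure β lam)) (Set.Iic t) := by
    intro t
    have e1 : (Measure.conv ω (renewalMeasure β lam)) (Set.Iic t) =
        ∫⁻ r, renewalDensity β lam r * ω (Set.Iic (t - r)) := by
      rw [Measure.conv_comm, ← lintegral_indicator_one measurableSet_Iic,
        Measure.lintegral_conv (measurable_one.indicator measurableSet_Iic), renewalMeasure,
        lintegral_withDensity_eq_lintegral_mul₀ (by fun_prop)]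
      · congr 1
        ext r
        simp only [Pi.mul_apply]
        congr 1
        rw [← lintegral_indicator_one measurableSet_Iic]
        congr 1
        ext v
        simp [Set.indicator, le_sub_iff_add_le, add_comm]
      · refine Measurable.aemeasurable (Measurable.lintegral_prod_right' (f := fun p : ℝ × ℝ =>
          (Set.Iic t).indicator (1 : ℝ → ENNReal) (p.1 + p.2)) ?_)
        exact (measurable_one.indicator measurableSet_Iic).comp measurable_add
    rw [Measure.add_apply, e1]
    rcases le_or_gt t 0 with ht | ht
    · rw [renewalMeasure_Iic hβ₀ hlam, h.measure_Iic_of_nonpos hβ₀ ht, max_eq_right ht,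
        Real.zero_rpow hβ₀.ne']
      have : ∀ r, renewalDensity β lam r * ω (Set.Iic (t - r)) = 0 := by
        intro r
        rcases le_or_gt r 0 with hr | hr
        · rw [renewalDensity_of_nonpos hr, zero_mul]
        · rw [h.measure_Iic_of_nonpos hβ₀ (by linarith), mul_zero]
      simp [this]
    · have e2 : ∫⁻ r, renewalDensity β lam r * ω (Set.Iic (t - r)) =
          ∫⁻ r in Set.Ioc 0 t, renewalDensity β lam r * ω (Set.Iic (t - r)) := by
        rw [← lintegral_indicator measurableSet_Ioc]
        congr 1
        ext r
        by_cases hr : r ∈ Set.Ioc 0 t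
        · simp [hr]
        · rw [Set.indicator_of_notMem hr]
          rcases le_or_gt r 0 with hr0 | hr0
          · rw [renewalDensity_of_nonpos hr0, zero_mul]
          · have : t < r := by
              by_contra hc
              exact hr ⟨hr0, not_lt.1 hc⟩
            rw [h.measure_Iic_of_nonpos hβ₀ (by linarith), mul_zero]
      rw [e2, h.measure_Iic_eq hβ₀ hβ₁ hlam ht.le, ← lintegral_add_left, renewalMeasure_Iic hβ₀ hlam,
        max_eq_left ht.le, ← (integral_rpow_sub_one hβ₀ hlam ht.le).2]
      · congr 1
        ext r
        rw [← mul_add, add_comm, ← Set.compl_Iic, prob_add_prob_compl measurableSet_Iic, mul_one]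
      · exact (measurable_renewalDensity β lam).mul
          ((measurable_measure_Ioi ω).comp (measurable_const.sub measurable_id))
  refine Measure.ext_of_Ioc _ _ fun a b hab => ?_
  have hfin : ∀ t, renewalMeasure β lam (Set.Iic t) ≠ ⊤ := fun t => by
    rw [renewalMeasure_Iic hβ₀ hlam]; exact ENNReal.ofReal_ne_top
  rw [← Set.Iic_sdiff_Iic, measure_sdiff (Set.Iic_subset_Iic.2 hab.le)
    measurableSet_Iic.nullMeasurableSet (hfin a), measure_sdiff (Set.Iic_subset_Iic.2 hab.le)
    measurableSet_Iic.nullMeasurableSet (hIic a ▸ hfin a), hIic, hIic]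

/-- The iterated convolutions of the waiting time law add up to at most the renewal measure. -/
theorem sum_lintegral_le (h : IsMittagLefflerLaw β lam ω) (hβ₀ : 0 < β) (hβ₁ : β < 1)
    (hlam : 0 < lam) (κ : ℕ → Measure ℝ) (hκ0 : κ 0 = ω) (hκ : ∀ n, κ (n + 1) = Measure.conv ω (κ n))
    [∀ n, SFinite (κ n)] {g : ℝ → ENNReal} (hg : Measurable g) :
    ∑' n, ∫⁻ r, g r ∂(κ n) ≤ ∫⁻ r, g r ∂(renewalMeasure β lam) := by
  have := h.isProb
  have := isLocallyFiniteMeasure_renewalMeasure hβ₀ hlam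
  refine ENNReal.tsum_le_of_sum_range_le fun n => ?_
  induction n generalizing g with
  | zero => simp
  | succ n ih =>
    rw [Finset.sum_range_succ', h.renewalMeasure_eq hβ₀ hβ₁ hlam, lintegral_add_measure, hκ0,
      add_comm]
    gcongr
    simp_rw [hκ, Measure.lintegral_conv hg]
    rw [← lintegral_finsetSum]
    · refine lintegral_mono fun x => ih (hg.comp (measurable_const_add x))
    · intro i _
      exact Measurable.lintegral_prod_right' (f := fun p : ℝ × ℝ => g (p.1 + p.2))
        (hg.comp measurable_add)

end IsMittagLefflerLaw

namespace IsMittagLefflerLaw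

variable {β lam : ℝ} {ω : Measure ℝ}

theorem eq (h : IsMittagLefflerLaw β lam ω) {ω' : Measure ℝ} (h' : IsMittagLefflerLaw β lam ω')
    (hβ₀ : 0 < β) : ω = ω' := by
  have := h.isProb
  have := h'.isProb
  refine Measure.ext_of_Iic _ _ fun t => ?_
  rcases le_or_gt t 0 with ht | ht
  · rw [h.measure_Iic_of_nonpos hβ₀ ht, h'.measure_Iic_of_nonpos hβ₀ ht]
  · have h1 := (h.survival t ht.le).trans (h'.survival t ht.le).symm
    have h2 := probReal_compl_eq_one_sub (μ := ω) (measurableSet_Ioi (a := t))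
    have h3 := probReal_compl_eq_one_sub (μ := ω') (measurableSet_Ioi (a := t))
    rw [Set.compl_Ioi] at h2 h3
    rw [← ofReal_measureReal (μ := ω), ← ofReal_measureReal (μ := ω'), h2, h3, h1]

theorem lintegral_window_le (h : IsMittagLefflerLaw β lam ω) (hβ₀ : 0 < β) (hβ₁ : β < 1)
    (hlam : 0 < lam) {a y : ℝ} (c : ENNReal)
    (hc : ∀ w ∈ Set.Ioc 0 y, renewalDensity β lam (a + w) ≤ c * renewalDensity β lam w) :
    ∫⁻ r in Set.Ioc a (a + y), ω (Set.Ioi (a + y - r)) ∂(renewalMeasure β lam) ≤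
      c * ω (Set.Iic y) := by
  have hm : Measurable fun r => ω (Set.Ioi (a + y - r)) :=
    (measurable_measure_Ioi ω).comp (measurable_const_sub (a + y))
  rcases lt_or_ge y 0 with hy | hy
  · rw [Set.Ioc_eq_empty (by linarith)]
    simp
  rw [h.measure_Iic_eq hβ₀ hβ₁ hlam hy, renewalMeasure,
    setLIntegral_withDensity_eq_setLIntegral_mul _ (by fun_prop) hm measurableSet_Ioc,
    ← lintegral_indicator measurableSet_Ioc, ← lintegral_add_left_eq_self _ a,
    ← lintegral_const_mul, ← lintegral_indicator measurableSet_Ioc]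
  · refine lintegral_mono fun w => ?_
    by_cases hw : w ∈ Set.Ioc 0 y
    · have hw' : a + w ∈ Set.Ioc a (a + y) := ⟨by linarith [hw.1], by linarith [hw.2]⟩
      rw [Set.indicator_of_mem hw, Set.indicator_of_mem hw', ← mul_assoc]
      simp only [Pi.mul_apply, add_sub_add_left_eq_sub]
      gcongr
      exact hc w hw
    · have hw' : a + w ∉ Set.Ioc a (a + y) := fun hc =>
        hw ⟨by linarith [hc.1], by linarith [hc.2]⟩
      rw [Set.indicator_of_notMem hw']
      exact zero_le
  · exact (measurable_renewalDensity β lam).mul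
      ((measurable_measure_Ioi ω).comp (measurable_const_sub y))

/-- The probability of a renewal in a window is largest for the window starting at the origin. -/
theorem lintegral_window_le_measure_Iic (h : IsMittagLefflerLaw β lam ω) (hβ₀ : 0 < β)
    (hβ₁ : β < 1) (hlam : 0 < lam) {a y : ℝ} (ha : 0 ≤ a) :
    ∫⁻ r in Set.Ioc a (a + y), ω (Set.Ioi (a + y - r)) ∂(renewalMeasure β lam) ≤
      ω (Set.Iic y) := by
  rw [← one_mul (ω (Set.Iic y))]
  refine h.lintegral_window_le hβ₀ hβ₁ hlam 1 fun w hw => ?_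
  have := Real.Gamma_pos_of_pos hβ₀
  rw [one_mul, renewalDensity_of_pos hw.1, renewalDensity_of_pos (by linarith [hw.1])]
  refine ENNReal.ofReal_le_ofReal ?_
  have := Real.rpow_le_rpow_of_nonpos hw.1 (show w ≤ a + w by linarith)
    (show β - 1 ≤ 0 by linarith)
  gcongr

theorem lintegral_window_le_mul_measure_Iic (h : IsMittagLefflerLaw β lam ω) (hβ₀ : 0 < β)
    (hβ₁ : β < 1) (hlam : 0 < lam) {a y : ℝ} (ha : 1 ≤ a) :
    ∫⁻ r in Set.Ioc a (a + y), ω (Set.Ioi (a + y - r)) ∂(renewalMeasure β lam) ≤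
      ENNReal.ofReal ((y / (1 + y)) ^ (1 - β)) * ω (Set.Iic y) := by
  refine h.lintegral_window_le hβ₀ hβ₁ hlam _ fun w hw => ?_
  have hΓ := Real.Gamma_pos_of_pos hβ₀
  have hw0 : 0 < w := hw.1
  have hy0 : 0 < y := by linarith [hw.2]
  rw [renewalDensity_of_pos hw0, renewalDensity_of_pos (by linarith),
    ← ENNReal.ofReal_mul (by positivity)]
  refine ENNReal.ofReal_le_ofReal ?_
  have h1 : (a + w) ^ (β - 1) ≤ (w * ((1 + y) / y)) ^ (β - 1) := by
    refine Real.rpow_le_rpow_of_nonpos (by positivity) ?_ (by linarith)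
    rw [← mul_div_assoc, div_le_iff₀ hy0]
    nlinarith [hw.2]
  have h2 : (w * ((1 + y) / y)) ^ (β - 1) = w ^ (β - 1) * (y / (1 + y)) ^ (1 - β) := by
    rw [Real.mul_rpow hw0.le (by positivity), ← inv_div y (1 + y), Real.inv_rpow (by positivity),
      ← Real.rpow_neg (by positivity), neg_sub]
  calc _ ≤ lam / Real.Gamma β * (w ^ (β - 1) * (y / (1 + y)) ^ (1 - β)) := by
        rw [← h2]; gcongr
    _ = _ := by ring

theorem lintegral_lintegral_window_add_le (h : IsMittagLefflerLaw β lam ω) (hβ₀ : 0 < β)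
    (hβ₁ : β < 1) (hlam : 0 < lam) (x y : ℝ) :
    ∫⁻ v in Set.Iic x, ∫⁻ r in Set.Ioc (x - v) (x - v + y), ω (Set.Ioi (x - v + y - r))
      ∂(renewalMeasure β lam) ∂ω +
      (Set.Ici (2 : ℝ)).indicator 1 x * (ω (Set.Iic 1) *
        (ENNReal.ofReal (1 - (y / (1 + y)) ^ (1 - β)) * ω (Set.Iic y))) ≤
      ω (Set.Iic x) * ω (Set.Iic y) := by
  rcases lt_or_ge x 2 with hx | hx
  · rw [Set.indicator_of_notMem (by simpa using hx), zero_mul, add_zero, mul_comm,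
      ← setLIntegral_const]
    refine setLIntegral_mono measurable_const fun v hv => ?_
    exact h.lintegral_window_le_measure_Iic hβ₀ hβ₁ hlam (sub_nonneg.2 hv)
  · rw [Set.indicator_of_mem (by simpa using hx), Pi.one_apply, one_mul]
    have hsplit : Set.Iic x = Set.Iic 1 ∪ Set.Ioc 1 x := (Set.Iic_union_Ioc_eq_Iic (by linarith)).symm
    have hdisj : Disjoint (Set.Iic 1) (Set.Ioc 1 x) := Set.Iic_disjoint_Ioc le_rfl
    rw [hsplit, lintegral_union measurableSet_Ioc hdisj, measure_union hdisj measurableSet_Ioc]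
    have h1 := setLIntegral_mono (μ := ω) (s := Set.Iic 1)
      (f := fun v => ∫⁻ r in Set.Ioc (x - v) (x - v + y), ω (Set.Ioi (x - v + y - r))
        ∂(renewalMeasure β lam))
      (measurable_const (a := ENNReal.ofReal ((y / (1 + y)) ^ (1 - β)) * ω (Set.Iic y)))
      (fun v hv => h.lintegral_window_le_mul_measure_Iic hβ₀ hβ₁ hlam (a := x - v) (y := y)
        (by linarith [Set.mem_Iic.1 hv]))
    have h2 := setLIntegral_mono (μ := ω) (s := Set.Ioc 1 x)
      (f := fun v => ∫⁻ r in Set.Ioc (x - v) (x - v + y), ω (Set.Ioi (x - v + y - r))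
        ∂(renewalMeasure β lam))
      (measurable_const (a := ω (Set.Iic y)))
      (fun v hv => h.lintegral_window_le_measure_Iic hβ₀ hβ₁ hlam (a := x - v) (y := y)
        (by linarith [hv.2]))
    rw [setLIntegral_const] at h1 h2
    have h3 : (ENNReal.ofReal ((y / (1 + y)) ^ (1 - β)) +
        ENNReal.ofReal (1 - (y / (1 + y)) ^ (1 - β))) * ω (Set.Iic y) = ω (Set.Iic y) := by
      rcases le_or_gt y 0 with hy | hy
      · rw [h.measure_Iic_of_nonpos hβ₀ hy, mul_zero]
      · have : (y / (1 + y)) ^ (1 - β) ≤ 1 :=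
          Real.rpow_le_one (by positivity) ((div_le_one (by positivity)).2 (by linarith))
            (by linarith)
        rw [← ENNReal.ofReal_add (by positivity) (by linarith)]
        simp
    calc _ ≤ ENNReal.ofReal ((y / (1 + y)) ^ (1 - β)) * ω (Set.Iic y) * ω (Set.Iic 1) +
          ω (Set.Iic y) * ω (Set.Ioc 1 x) + ω (Set.Iic 1) *
            (ENNReal.ofReal (1 - (y / (1 + y)) ^ (1 - β)) * ω (Set.Iic y)) := by gcongr
      _ = ω (Set.Iic 1) * ((ENNReal.ofReal ((y / (1 + y)) ^ (1 - β)) +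
        ENNReal.ofReal (1 - (y / (1 + y)) ^ (1 - β))) * ω (Set.Iic y)) +
          ω (Set.Iic y) * ω (Set.Ioc 1 x) := by ring
      _ = _ := by rw [h3]; ring

end IsMittagLefflerLaw

theorem IndepFun.prodMk_left_of_prodMk_right {Ω α β γ : Type*} [MeasurableSpace Ω]
    [MeasurableSpace α] [MeasurableSpace β] [MeasurableSpace γ] {P : Measure Ω}
    [IsProbabilityMeasure P] {Z : Ω → α} {A : Ω → β} {B : Ω → γ} (hZ : Measurable Z)
    (hA : Measurable A) (hB : Measurable B) (hZAB : IndepFun Z (fun ω => (A ω, B ω)) P)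
    (hAB : IndepFun A B P) : IndepFun (fun ω => (Z ω, A ω)) B P := by
  have := Measure.isProbabilityMeasure_map (μ := P) hZ.aemeasurable
  have := Measure.isProbabilityMeasure_map (μ := P) hA.aemeasurable
  have := Measure.isProbabilityMeasure_map (μ := P) hB.aemeasurable
  have hZA : IndepFun Z A P := hZAB.comp measurable_id measurable_fst
  rw [indepFun_iff_map_prod_eq_prod_map_map (by fun_prop) (by fun_prop)] at hZAB hAB hZA ⊢
  rw [hZA]
  have h1 : (fun ω => ((Z ω, A ω), B ω)) =
      MeasurableEquiv.prodAssoc.symm ∘ fun ω => (Z ω, (A ω, B ω)) := rfl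
  rw [h1, ← Measure.map_map (by fun_prop) (by fun_prop), hZAB, hAB, ← Measure.prodAssoc_prod,
    MeasurableEquiv.map_symm_map]

theorem measure_le_eq_lintegral {Ω : Type*} [MeasurableSpace Ω] {P : Measure Ω}
    [IsProbabilityMeasure P] {V X : Ω → ℝ} (hV : Measurable V) (hX : Measurable X)
    (hVX : IndepFun X V P) :
    P {a | V a ≤ X a} = ∫⁻ x, (P.map V) (Set.Iic x) ∂(P.map X) := by
  have := Measure.isProbabilityMeasure_map (μ := P) hV.aemeasurable
  have hS : MeasurableSet {p : ℝ × ℝ | p.2 ≤ p.1} := measurableSet_le (by fun_prop) (by fun_prop)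
  have h1 := (indepFun_iff_map_prod_eq_prod_map_map (by fun_prop) (by fun_prop)).1 hVX
  have h2 : P {a | V a ≤ X a} = (P.map fun a => (X a, V a)) {p : ℝ × ℝ | p.2 ≤ p.1} := by
    rw [Measure.map_apply (by fun_prop) hS]
    rfl
  rw [h2, h1, Measure.prod_apply hS]
  rfl

theorem tsum_measure_last_renewal_add_le {Ω : Type*} [MeasurableSpace Ω] {P : Measure Ω}
    [IsProbabilityMeasure P] {β lam : ℝ} (hβ₀ : 0 < β) (hβ₁ : β < 1) (hlam : 0 < lam)
    {ω : Measure ℝ} (h : IsMittagLefflerLaw β lam ω) {W : ℕ → Ω → ℝ} (hW : ∀ i, Measurable (W i))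
    (hWind : iIndepFun W P) (hWlaw : ∀ i, P.map (W i) = ω) {X Y : Ω → ℝ} (hX : Measurable X)
    (hY : Measurable Y) (hXY : IndepFun X Y P)
    (hXYW : IndepFun (fun ω => (X ω, Y ω)) (fun ω i => W i ω) P) :
    ∑' m : ℕ, P {a | W 0 a ≤ X a ∧ X a < W 0 a + ∑ i ∈ Finset.range (m + 1), W (i + 1) a ∧
      W 0 a + ∑ i ∈ Finset.range (m + 1), W (i + 1) a ≤ X a + Y a ∧
      X a + Y a < W 0 a + ∑ i ∈ Finset.range (m + 1), W (i + 1) a + W (m + 2) a} +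
      P {a | 2 ≤ X a} * (ω (Set.Iic 1) * ∫⁻ a,
        ENNReal.ofReal (1 - (Y a / (1 + Y a)) ^ (1 - β)) * ω (Set.Iic (Y a)) ∂P) ≤
      P {a | W 0 a ≤ X a} * P {a | W 0 a ≤ Y a} := by
  have := h.isProb
  have := IsMittagLefflerLaw.isLocallyFiniteMeasure_renewalMeasure hβ₀ hlam
  have hpX := Measure.isProbabilityMeasure_map (μ := P) hX.aemeasurable
  have hpY := Measure.isProbabilityMeasure_map (μ := P) hY.aemeasurable
  let R : ℕ → Ω → ℝ := fun m a => ∑ i ∈ Finset.range (m + 1), W (i + 1) a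
  have hR : ∀ m, Measurable (R m) := fun m => Finset.measurable_fun_sum _ fun i _ => hW _
  have hpR : ∀ m, IsProbabilityMeasure (P.map (R m)) := fun m =>
    Measure.isProbabilityMeasure_map (hR m).aemeasurable
  have hWshift : iIndepFun (fun i => W (i + 1)) P := hWind.precomp (add_left_injective 1)
  have hκ0 : P.map (R 0) = ω := by
    rw [← hWlaw 1]; congr 1; ext a; simp [R]
  have hκ : ∀ m, P.map (R (m + 1)) = Measure.conv ω (P.map (R m)) := by
    intro m
    have h1 : R (m + 1) = R m + W (m + 2) := by
      ext a; simp [R, Finset.sum_range_succ]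
    have h2 : IndepFun (R m) (W (m + 2)) P := by
      have := hWshift.indepFun_sum_range_succ (fun i => hW _) (m + 1)
      convert this using 1
      ext a; simp [R]
    rw [h1, h2.map_add_eq_map_conv_map (hR m) (hW _), hWlaw, Measure.conv_comm]
  let Z : Ω → ℝ × ℝ := fun a => (X a, Y a)
  have hZ : Measurable Z := hX.prodMk hY
  have hZlaw : P.map Z = (P.map X).prod (P.map Y) :=
    (indepFun_iff_map_prod_eq_prod_map_map (by fun_prop) (by fun_prop)).1 hXY
  have hZW0 : IndepFun Z (W 0) P := hXYW.comp measurable_id (measurable_pi_apply 0)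
  have hp0 : P.map (fun a => (Z a, W 0 a)) = ((P.map X).prod (P.map Y)).prod ω := by
    rw [(indepFun_iff_map_prod_eq_prod_map_map (by fun_prop) (by fun_prop)).1 hZW0, hZlaw, hWlaw]
  have hp1 : ∀ m, P.map (fun a => ((Z a, W 0 a), R m a)) =
      (((P.map X).prod (P.map Y)).prod ω).prod (P.map (R m)) := by
    intro m
    have hW0R : IndepFun (W 0) (R m) P := by
      have h1 := hWind.indepFun_finset {0} (Finset.Icc 1 (m + 1)) (by simp) hW
      have hφ : Measurable fun f : ({0} : Finset ℕ) → ℝ => f ⟨0, by simp⟩ := measurable_pi_apply _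
      have hψ : Measurable fun f : Finset.Icc 1 (m + 1) → ℝ =>
        ∑ i : Fin (m + 1), f ⟨i + 1, by simp; omega⟩ := by fun_prop
      have h2 := h1.comp hφ hψ
      refine h2.congr .rfl (Filter.Eventually.of_forall fun a => ?_)
      simp [R, Finset.sum_range]
    have h3 : IndepFun Z (fun a => (W 0 a, R m a)) P :=
      hXYW.comp (φ := id) (ψ := fun f : ℕ → ℝ => (f 0, ∑ i ∈ Finset.range (m + 1), f (i + 1)))
        measurable_id (by fun_prop)
    rw [(indepFun_iff_map_prod_eq_prod_map_map (by fun_prop) (hR m).aemeasurable).1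
      (IndepFun.prodMk_left_of_prodMk_right hZ (hW 0) (hR m) h3 hW0R), hp0]
  have hp2 : ∀ m, P.map (fun a => (((Z a, W 0 a), R m a), W (m + 2) a)) =
      ((((P.map X).prod (P.map Y)).prod ω).prod (P.map (R m))).prod ω := by
    intro m
    have hW0R : IndepFun (fun a => (W 0 a, R m a)) (W (m + 2)) P := by
      have h1 := hWind.indepFun_finset (Finset.range (m + 2)) {m + 2} (by simp) hW
      have hφ : Measurable fun f : Finset.range (m + 2) → ℝ =>
        (f ⟨0, by simp⟩, ∑ i : Fin (m + 1), f ⟨i + 1, by simp; omega⟩) := by fun_prop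
      have hψ : Measurable fun f : ({m + 2} : Finset ℕ) → ℝ => f ⟨m + 2, by simp⟩ :=
        measurable_pi_apply _
      have h2 := h1.comp hφ hψ
      refine h2.congr (Filter.Eventually.of_forall fun a => ?_) .rfl
      simp [R, Finset.sum_range]
    have h3 : IndepFun Z (fun a => ((W 0 a, R m a), W (m + 2) a)) P :=
      hXYW.comp (φ := id)
        (ψ := fun f : ℕ → ℝ => ((f 0, ∑ i ∈ Finset.range (m + 1), f (i + 1)), f (m + 2)))
        measurable_id (by fun_prop)
    have h4 := IndepFun.prodMk_left_of_prodMk_right hZ ((hW 0).prodMk (hR m)) (hW (m + 2)) h3 hW0R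
    have h5 : IndepFun (fun a => ((Z a, W 0 a), R m a)) (W (m + 2)) P :=
      h4.comp (φ := fun p : (ℝ × ℝ) × (ℝ × ℝ) => ((p.1, p.2.1), p.2.2)) (ψ := id)
        (by fun_prop) measurable_id
    rw [(indepFun_iff_map_prod_eq_prod_map_map
      ((hZ.prodMk (hW 0)).prodMk (hR m)).aemeasurable (by fun_prop)).1 h5, hp1, hWlaw]
  let S : Set ((((ℝ × ℝ) × ℝ) × ℝ) × ℝ) := {p | p.1.1.2 ≤ p.1.1.1.1 ∧
    p.1.1.1.1 < p.1.1.2 + p.1.2 ∧ p.1.1.2 + p.1.2 ≤ p.1.1.1.1 + p.1.1.1.2 ∧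
    p.1.1.1.1 + p.1.1.1.2 < p.1.1.2 + p.1.2 + p.2}
  have hS : MeasurableSet S := by
    simp only [S, Set.ofPred_and]
    refine MeasurableSet.inter ?_ (MeasurableSet.inter ?_ (MeasurableSet.inter ?_ ?_))
    · exact measurableSet_le (by fun_prop) (by fun_prop)
    · exact measurableSet_lt (by fun_prop) (by fun_prop)
    · exact measurableSet_le (by fun_prop) (by fun_prop)
    · exact measurableSet_lt (by fun_prop) (by fun_prop)
  let H : ((ℝ × ℝ) × ℝ) × ℝ → ENNReal := fun q => ω (Prod.mk q ⁻¹' S)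
  have hH : Measurable H := measurable_measure_prodMk_left hS
  have hterm : ∀ m : ℕ, P {a | W 0 a ≤ X a ∧
      X a < W 0 a + ∑ i ∈ Finset.range (m + 1), W (i + 1) a ∧
      W 0 a + ∑ i ∈ Finset.range (m + 1), W (i + 1) a ≤ X a + Y a ∧
      X a + Y a < W 0 a + ∑ i ∈ Finset.range (m + 1), W (i + 1) a + W (m + 2) a} =
      ∫⁻ p, ∫⁻ r, H (p, r) ∂(P.map (R m)) ∂(((P.map X).prod (P.map Y)).prod ω) := by
    intro m
    rw [← lintegral_prod _ hH.aemeasurable, ← Measure.prod_apply hS, ← hp2,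
      Measure.map_apply (((hZ.prodMk (hW 0)).prodMk (hR m)).prodMk (hW _)) hS]
    rfl
  simp_rw [hterm]
  rw [← lintegral_tsum fun m => hH.lintegral_prod_right'.aemeasurable]
  have hHle : ∫⁻ p, ∑' m, ∫⁻ r, H (p, r) ∂(P.map (R m)) ∂(((P.map X).prod (P.map Y)).prod ω) ≤
      ∫⁻ p, ∫⁻ r, H (p, r) ∂(renewalMeasure β lam) ∂(((P.map X).prod (P.map Y)).prod ω) :=
    lintegral_mono fun p => h.sum_lintegral_le hβ₀ hβ₁ hlam (fun m => P.map (R m)) hκ0 hκ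
      (hH.comp measurable_prodMk_left)
  have hsec : ∀ x y v : ℝ, ∫⁻ r, H (((x, y), v), r) ∂(renewalMeasure β lam) =
      (Set.Iic x).indicator (fun v => ∫⁻ r in Set.Ioc (x - v) (x - v + y),
        ω (Set.Ioi (x - v + y - r)) ∂(renewalMeasure β lam)) v := by
    intro x y v
    by_cases hv : v ≤ x
    · rw [Set.indicator_of_mem (by exact hv), ← lintegral_indicator measurableSet_Ioc]
      refine lintegral_congr fun r => ?_
      by_cases hr : r ∈ Set.Ioc (x - v) (x - v + y)
      · rw [Set.indicator_of_mem hr]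
        simp only [H]
        congr 1
        ext w
        simp only [S, Set.mem_preimage, Set.mem_ofPred_eq, Set.mem_Ioi]
        constructor
        · rintro ⟨_, _, _, h4⟩; linarith
        · intro h4
          exact ⟨hv, by linarith [hr.1], by linarith [hr.2], by linarith⟩
      · rw [Set.indicator_of_notMem hr]
        simp only [H]
        convert measure_empty (μ := ω)
        ext w
        simp only [S, Set.mem_preimage, Set.mem_ofPred_eq, Set.mem_empty_iff_false, iff_false]
        rintro ⟨_, h2, h3, _⟩
        exact hr ⟨by linarith, by linarith⟩
    · rw [Set.indicator_of_notMem (by exact hv)]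
      convert lintegral_zero with r
      simp only [H]
      convert measure_empty (μ := ω)
      ext w
      simp only [S, Set.mem_preimage, Set.mem_ofPred_eq, Set.mem_empty_iff_false, iff_false]
      rintro ⟨h1, _⟩
      exact hv h1
  rw [lintegral_prod _ hH.lintegral_prod_right'.aemeasurable] at hHle
  simp_rw [hsec, lintegral_indicator measurableSet_Iic] at hHle
  have hf : Measurable fun x => ω (Set.Iic x) := measurable_measure_Iic ω
  have hq : Measurable fun y : ℝ =>
      ENNReal.ofReal (1 - (y / (1 + y)) ^ (1 - β)) * ω (Set.Iic y) := by
    refine Measurable.mul ?_ hf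
    fun_prop
  have hind : Measurable ((Set.Ici (2 : ℝ)).indicator (1 : ℝ → ENNReal)) :=
    measurable_one.indicator measurableSet_Ici
  have e1 : P {a | 2 ≤ X a} = ∫⁻ x, (Set.Ici (2 : ℝ)).indicator 1 x ∂(P.map X) := by
    rw [lintegral_indicator_one measurableSet_Ici, Measure.map_apply hX measurableSet_Ici]
    rfl
  have e2 : P {a | W 0 a ≤ X a} = ∫⁻ x, ω (Set.Iic x) ∂(P.map X) := by
    rw [← hWlaw 0]
    exact measure_le_eq_lintegral (hW 0) hX
      (hXYW.comp (φ := Prod.fst) (ψ := fun f : ℕ → ℝ => f 0) measurable_fst (by fun_prop))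
  have e3 : P {a | W 0 a ≤ Y a} = ∫⁻ y, ω (Set.Iic y) ∂(P.map Y) := by
    rw [← hWlaw 0]
    exact measure_le_eq_lintegral (hW 0) hY
      (hXYW.comp (φ := Prod.snd) (ψ := fun f : ℕ → ℝ => f 0) measurable_snd (by fun_prop))
  rw [e1, e2, e3, ← lintegral_map (f := fun y => ENNReal.ofReal (1 - (y / (1 + y)) ^ (1 - β)) *
    ω (Set.Iic y)) hq hY, ← lintegral_const_mul _ hq,
    ← lintegral_prod_mul hind.aemeasurable (hq.const_mul _).aemeasurable,
    ← lintegral_prod_mul hf.aemeasurable hf.aemeasurable]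
  refine (add_le_add_left hHle _).trans ?_
  have hg : Measurable fun z : ℝ × ℝ => (Set.Ici (2 : ℝ)).indicator (1 : ℝ → ENNReal) z.1 *
      (ω (Set.Iic 1) * (ENNReal.ofReal (1 - (z.2 / (1 + z.2)) ^ (1 - β)) * ω (Set.Iic z.2))) :=
    (hind.comp measurable_fst).mul ((hq.const_mul _).comp measurable_snd)
  rw [← lintegral_add_right _ hg]
  exact lintegral_mono fun z => h.lintegral_lintegral_window_add_le hβ₀ hβ₁ hlam z.1 z.2

namespace IsMittagLefflerSubordinator

variable {Ω : Type*} [MeasurableSpace Ω] {P : Measure Ω} [IsProbabilityMeasure P]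
  {α ρ μ : ℝ} {M : ℝ≥0 → Ω → ℝ≥0}

theorem integrable_one_sub_exp (h : IsMittagLefflerSubordinator P α ρ μ M) (t : ℝ≥0) {u : ℝ}
    (hu : 0 ≤ u) : Integrable (fun a => 1 - Real.exp (-u * (M t a : ℝ))) P := by
  have hm := h.measurable t
  refine Integrable.of_bound (C := 1) (by fun_prop) (Filter.Eventually.of_forall fun a => ?_)
  have h1 : Real.exp (-u * (M t a : ℝ)) ≤ 1 := Real.exp_le_one_iff.2 (by
    have := mul_nonneg hu (M t a).coe_nonneg
    linarith)
  have h2 := Real.exp_pos (-u * (M t a : ℝ))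
  rw [Real.norm_eq_abs, abs_le]
  constructor <;> linarith

theorem integral_one_sub_exp (h : IsMittagLefflerSubordinator P α ρ μ M) (hμ : 0 < μ) (t : ℝ≥0)
    {u : ℝ} (hu : 0 ≤ u) : ∫ a, (1 - Real.exp (-u * (M t a : ℝ))) ∂P =
      1 - Real.exp (-(ρ * t * Real.log (1 + u ^ α / μ))) := by
  have hint : Integrable (fun a => Real.exp (-u * (M t a : ℝ))) P := by
    have := (integrable_const (1 : ℝ)).sub (h.integrable_one_sub_exp t hu)
    refine this.congr (Filter.Eventually.of_forall fun a => ?_)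
    simp
  have h0 : 0 ≤ u ^ α := Real.rpow_nonneg hu α
  rw [integral_sub (integrable_const _) hint, h.laplace t u hu]
  have e : μ / (μ + u ^ α) = (1 + u ^ α / μ)⁻¹ := by field_simp
  rw [e, Real.rpow_def_of_pos (by positivity), Real.log_inv]
  simp only [integral_const, probReal_univ, smul_eq_mul, mul_one, sub_right_inj, Real.exp_eq_exp]
  ring

theorem measureReal_le_mul_log (h : IsMittagLefflerSubordinator P α ρ μ M) (hμ : 0 < μ)
    (t : ℝ≥0) {ε : ℝ} (hε : 0 < ε) :
    P.real {a | ε ≤ (M t a : ℝ)} ≤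
      (1 - Real.exp (-1))⁻¹ * (ρ * t * Real.log (1 + ε⁻¹ ^ α / μ)) := by
  have hm := h.measurable t
  have hpos : 0 < 1 - Real.exp (-1) := by
    have := Real.exp_lt_one_iff.2 (show (-1 : ℝ) < 0 by norm_num)
    linarith
  have hS : MeasurableSet {a | ε ≤ (M t a : ℝ)} := measurableSet_le (by fun_prop) (by fun_prop)
  have h1 : (1 - Real.exp (-1)) * P.real {a | ε ≤ (M t a : ℝ)} ≤
      ∫ a, (1 - Real.exp (-ε⁻¹ * (M t a : ℝ))) ∂P := by
    rw [mul_comm, ← smul_eq_mul, ← integral_indicator_const _ hS]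
    refine integral_mono ((integrable_const _).indicator hS)
      (h.integrable_one_sub_exp t (inv_nonneg.2 hε.le)) fun a => ?_
    by_cases ha : ε ≤ (M t a : ℝ)
    · rw [Set.indicator_of_mem (by exact ha)]
      have : Real.exp (-ε⁻¹ * (M t a : ℝ)) ≤ Real.exp (-1) := by
        refine Real.exp_le_exp.2 ?_
        have := mul_le_mul_of_nonneg_left ha (inv_nonneg.2 hε.le)
        rw [inv_mul_cancel₀ hε.ne'] at this
        linarith
      simp only
      linarith
    · rw [Set.indicator_of_notMem (by exact ha)]
      have : Real.exp (-ε⁻¹ * (M t a : ℝ)) ≤ 1 := Real.exp_le_one_iff.2 (by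
        have := mul_nonneg (inv_nonneg.2 hε.le) (M t a).coe_nonneg
        linarith)
      simp only
      linarith
  rw [h.integral_one_sub_exp hμ t (inv_nonneg.2 hε.le)] at h1
  rw [inv_mul_eq_div, le_div_iff₀ hpos, mul_comm]
  have := Real.add_one_le_exp (-(ρ * t * Real.log (1 + ε⁻¹ ^ α / μ)))
  linarith

/-- The probability of a large jump is at least linear in time. -/
theorem exists_mul_le_measureReal (h : IsMittagLefflerSubordinator P α ρ μ M) (hα₀ : 0 < α)
    (hα₁ : α < 1) (hρ : 0 < ρ) (hμ : 0 < μ) :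
    ∃ c > 0, ∃ s₀ > 0, ∀ s : ℝ≥0, (s : ℝ) ≤ s₀ → c * s ≤ P.real {a | 2 ≤ (M s a : ℝ)} := by
  let L : ℝ → ℝ := fun u => Real.log (1 + u ^ α / μ)
  have hL1 : 0 < L 1 := Real.log_pos (by rw [Real.one_rpow]; linarith [div_pos one_pos hμ])
  obtain ⟨u, hu0, hu1, hu⟩ : ∃ u : ℝ, 0 < u ∧ u ≤ 1 ∧ Real.exp 2 * u * L 1 < L u := by
    have hlim : Filter.Tendsto (fun u : ℝ => u ^ (1 - α)) (nhdsWithin 0 (Set.Ioi 0)) (nhds 0) := by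
      have := (Real.continuousAt_rpow_const 0 (1 - α) (Or.inr (by linarith))).tendsto
      rw [Real.zero_rpow (by linarith)] at this
      exact this.mono_left nhdsWithin_le_nhds
    have hb : 0 < 1 / (Real.exp 2 * L 1 * (μ + 1)) := by positivity
    have h1 := hlim.eventually (gt_mem_nhds hb)
    have h2 : ∀ᶠ u : ℝ in nhdsWithin 0 (Set.Ioi 0), u ∈ Set.Ioc (0 : ℝ) 1 :=
      Ioc_mem_nhdsGT one_pos
    obtain ⟨u, hu, hu'⟩ := (h1.and h2).exists
    refine ⟨u, hu'.1, hu'.2, ?_⟩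
    have hua : 0 < u ^ α := Real.rpow_pos_of_pos hu'.1 α
    have hua1 : u ^ α ≤ 1 := Real.rpow_le_one hu'.1.le hu'.2 hα₀.le
    have hLu : u ^ α / (μ + 1) ≤ L u := by
      have h3 := Real.one_sub_inv_le_log_of_pos (show 0 < 1 + u ^ α / μ by positivity)
      have h4 : 1 - (1 + u ^ α / μ)⁻¹ = u ^ α / (μ + u ^ α) := by field_simp; ring
      rw [h4] at h3
      refine le_trans ?_ h3
      gcongr
    refine lt_of_lt_of_le ?_ hLu
    rw [lt_div_iff₀ (by positivity)] at hu ⊢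
    have h5 : u = u ^ (1 - α) * u ^ α := by
      rw [← Real.rpow_add hu'.1]; simp
    calc Real.exp 2 * u * L 1 * (μ + 1) = Real.exp 2 * (u ^ (1 - α) * u ^ α) * L 1 * (μ + 1) := by
          rw [← h5]
      _ = u ^ (1 - α) * (Real.exp 2 * L 1 * (μ + 1)) * u ^ α := by ring
      _ < 1 * u ^ α := by gcongr
      _ = u ^ α := one_mul _
  have hLu : 0 < L u := lt_trans (by positivity) hu
  set D := L u - Real.exp 2 * u * L 1 with hD
  have hDpos : 0 < D := by linarith
  refine ⟨ρ * D / 2, by positivity, D / (2 * ρ * L u ^ 2), by positivity, fun s hs => ?_⟩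
  have hm := h.measurable s
  have hS : MeasurableSet {a | 2 ≤ (M s a : ℝ)} := measurableSet_le (by fun_prop) (by fun_prop)
  have h1 : ∫ a, ((1 - Real.exp (-u * (M s a : ℝ))) - Real.exp 2 * u *
      (1 - Real.exp (-1 * (M s a : ℝ)))) ∂P ≤ P.real {a | 2 ≤ (M s a : ℝ)} := by
    rw [← integral_indicator_one hS]
    refine integral_mono ((h.integrable_one_sub_exp s hu0.le).sub
      ((h.integrable_one_sub_exp s zero_le_one).const_mul _))
      ((integrable_const _).indicator hS) fun a => ?_
    set x : ℝ := (M s a : ℝ) with hx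
    have hx0 : 0 ≤ x := (M s a).coe_nonneg
    have hex : Real.exp (-1 * x) ≤ 1 := Real.exp_le_one_iff.2 (by linarith)
    by_cases ha : 2 ≤ x
    · rw [Set.indicator_of_mem (by exact ha)]
      have := Real.exp_pos (-u * x)
      have : 0 ≤ Real.exp 2 * u * (1 - Real.exp (-1 * x)) :=
        mul_nonneg (by positivity) (by linarith)
      simp only [Pi.one_apply]
      linarith
    · rw [Set.indicator_of_notMem (by exact ha)]
      have h2 := Real.add_one_le_exp (-u * x)
      have h3 : x ≤ Real.exp 2 * (1 - Real.exp (-1 * x)) := by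
        have h4 := Real.add_one_le_exp x
        have h5 : Real.exp x ≤ Real.exp 2 := Real.exp_le_exp.2 (by linarith)
        have h6 : Real.exp x * Real.exp (-1 * x) = 1 := by rw [← Real.exp_add]; simp
        have h7 : Real.exp x * (1 - Real.exp (-1 * x)) ≤ Real.exp 2 * (1 - Real.exp (-1 * x)) :=
          mul_le_mul_of_nonneg_right h5 (by linarith)
        linarith
      have := mul_le_mul_of_nonneg_left h3 hu0.le
      simp only
      nlinarith
  rw [integral_sub (h.integrable_one_sub_exp s hu0.le)
    ((h.integrable_one_sub_exp s zero_le_one).const_mul _), integral_const_mul,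
    h.integral_one_sub_exp hμ s hu0.le, h.integral_one_sub_exp hμ s zero_le_one] at h1
  have hs0 : (0 : ℝ) ≤ s := s.2
  have h2 : 1 - Real.exp (-(ρ * s * L 1)) ≤ ρ * s * L 1 := by
    have := Real.add_one_le_exp (-(ρ * s * L 1))
    linarith
  have h3 : ρ * s * L u - (ρ * s * L u) ^ 2 ≤ 1 - Real.exp (-(ρ * s * L u)) := by
    set z := ρ * s * L u
    have hz : 0 ≤ z := by positivity
    have h4 := Real.add_one_le_exp z
    have h5 : Real.exp z * Real.exp (-z) = 1 := by rw [← Real.exp_add]; simp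
    have h6 := Real.exp_pos (-z)
    have h7 : (z + 1) * Real.exp (-z) ≤ 1 :=
      (mul_le_mul_of_nonneg_right h4 h6.le).trans_eq h5
    have h8 : (z + 1) * Real.exp (-z) ≤ (z + 1) * (1 - z + z ^ 2) := by
      have : 0 ≤ z ^ 3 := by positivity
      nlinarith
    have := le_of_mul_le_mul_left h8 (by linarith)
    linarith
  have h9 : Real.exp 2 * u * (1 - Real.exp (-(ρ * s * L 1))) ≤ Real.exp 2 * u * (ρ * s * L 1) := by
    gcongr
  have h10 : ρ * s * (ρ * s * L u ^ 2) ≤ ρ * s * (D / 2) := by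
    rw [le_div_iff₀ (by positivity)] at hs
    have : ρ * s * L u ^ 2 ≤ D / 2 := by linarith
    gcongr
  change (1 - Real.exp (-(ρ * s * L u))) - Real.exp 2 * u * (1 - Real.exp (-(ρ * s * L 1))) ≤ _ at h1
  have : ρ * s * D = ρ * s * L u - Real.exp 2 * u * (ρ * s * L 1) := by rw [hD]; ring
  nlinarith

theorem exists_measureReal_le_rpow (h : IsMittagLefflerSubordinator P α ρ μ M) (hα₀ : 0 < α)
    (hρ : 0 < ρ) (hμ : 0 < μ) {β : ℝ} (hβ₀ : 0 < β) :
    ∃ K, ∀ s : ℝ≥0, 0 < s → s ≤ 1 →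
      P.real {a | (s : ℝ) ^ β⁻¹ ≤ (M s a : ℝ)} ≤ K * (s : ℝ) ^ (3 / 4 : ℝ) := by
  have hpos : 0 < 1 - Real.exp (-1) := by
    have := Real.exp_lt_one_iff.2 (show (-1 : ℝ) < 0 by norm_num)
    linarith
  refine ⟨(1 - Real.exp (-1))⁻¹ * (ρ * (Real.log (1 + 1 / μ) + 4 * (α / β))), fun s hs hs1 => ?_⟩
  have hs0 : (0 : ℝ) < s := hs
  have hs1' : (s : ℝ) ≤ 1 := hs1
  refine (h.measureReal_le_mul_log hμ s (Real.rpow_pos_of_pos hs0 _)).trans ?_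
  rw [mul_assoc _ _ ((s : ℝ) ^ _), mul_assoc ρ, mul_assoc ρ]
  refine mul_le_mul_of_nonneg_left (mul_le_mul_of_nonneg_left ?_ hρ.le) (inv_pos.2 hpos).le
  have e1 : ((s : ℝ) ^ β⁻¹)⁻¹ ^ α = ((s : ℝ)⁻¹) ^ (α / β) := by
    rw [← Real.inv_rpow hs0.le, ← Real.rpow_mul (by positivity)]
    congr 1; ring
  have hinv : 1 ≤ (s : ℝ)⁻¹ := (one_le_inv₀ hs0).2 hs1'
  have h1 : 1 ≤ ((s : ℝ)⁻¹) ^ (α / β) := Real.one_le_rpow hinv (by positivity)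
  have h2 : Real.log (1 + ((s : ℝ)⁻¹) ^ (α / β) / μ) ≤
      Real.log (1 + 1 / μ) + α / β * Real.log ((s : ℝ)⁻¹) := by
    rw [← Real.log_rpow (by positivity), ← Real.log_mul (by positivity) (by positivity)]
    refine Real.log_le_log (by positivity) ?_
    rw [add_mul, one_mul, one_div_mul_eq_div]
    linarith
  have h3 : Real.log ((s : ℝ)⁻¹) ≤ ((s : ℝ)⁻¹) ^ (1 / 4 : ℝ) / (1 / 4) :=
    Real.log_le_rpow_div (by positivity) (by norm_num)
  have e2 : (s : ℝ) * ((s : ℝ)⁻¹) ^ (1 / 4 : ℝ) = (s : ℝ) ^ (3 / 4 : ℝ) := by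
    rw [Real.inv_rpow hs0.le, ← Real.rpow_neg hs0.le]
    nth_rw 1 [← Real.rpow_one (s : ℝ)]
    rw [← Real.rpow_add hs0]
    norm_num
  have h4 : (s : ℝ) ≤ (s : ℝ) ^ (3 / 4 : ℝ) := by
    nth_rw 1 [← Real.rpow_one (s : ℝ)]
    exact Real.rpow_le_rpow_of_exponent_ge hs0 hs1' (by norm_num)
  have h5 : 0 ≤ Real.log (1 + 1 / μ) := Real.log_nonneg (by linarith [div_pos one_pos hμ])
  have h6 : 0 ≤ α / β := by positivity
  rw [e1]
  calc _ ≤ (s : ℝ) * (Real.log (1 + 1 / μ) + α / β * (((s : ℝ)⁻¹) ^ (1 / 4 : ℝ) / (1 / 4))) := by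
        gcongr
        exact h2.trans (by gcongr)
    _ = s * Real.log (1 + 1 / μ) + 4 * (α / β) * (s * ((s : ℝ)⁻¹) ^ (1 / 4 : ℝ)) := by ring
    _ ≤ (s : ℝ) ^ (3 / 4 : ℝ) * Real.log (1 + 1 / μ) + 4 * (α / β) * (s : ℝ) ^ (3 / 4 : ℝ) := by
        rw [e2]; gcongr
    _ = _ := by ring

theorem measure_pos_ne_zero (h : IsMittagLefflerSubordinator P α ρ μ M) (hρ : 0 < ρ) (hμ : 0 < μ) :
    P {a | 0 < (M 1 a : ℝ)} ≠ 0 := by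
  intro h0
  have h1 := h.integral_one_sub_exp hμ 1 zero_le_one
  have h2 : ∫ a, (1 - Real.exp (-1 * (M 1 a : ℝ))) ∂P = 0 := by
    refine integral_eq_zero_of_ae ?_
    rw [← compl_mem_ae_iff] at h0
    filter_upwards [h0] with a ha
    have : (M 1 a : ℝ) = 0 := le_antisymm (not_lt.1 ha) (M 1 a).coe_nonneg
    simp [this]
  rw [h2, Real.one_rpow] at h1
  have h3 : 0 < Real.log (1 + 1 / μ) := Real.log_pos (by linarith [div_pos one_pos hμ])
  have h4 := Real.exp_lt_one_iff (x := -(ρ * (1 : ℝ≥0) * Real.log (1 + 1 / μ))).2 (by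
    have : 0 < ρ * ((1 : ℝ≥0) : ℝ) * Real.log (1 + 1 / μ) := by
      rw [NNReal.coe_one, mul_one]
      exact mul_pos hρ h3
    linarith)
  linarith

end IsMittagLefflerSubordinator

theorem IsInfinitelyDivisible.isProbabilityMeasure {E : Type*} [AddCommMonoid E]
    [MeasurableSpace E] {ν : Measure E} [MeasurableAdd₂ E] (hν : IsInfinitelyDivisible ν) :
    IsProbabilityMeasure ν := by
  obtain ⟨η, hη, rfl⟩ := hν 1 le_rfl
  exact Measure.isProbabilityMeasure_map
    (Finset.measurable_fun_sum _ fun i _ => measurable_pi_apply i).aemeasurable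

theorem IsInfinitelyDivisible.mul_sub_le_measureReal {E : Type*} [AddCommMonoid E]
    [MeasurableSpace E] [MeasurableAdd₂ E] {ν : Measure E} (hν : IsInfinitelyDivisible ν)
    (a b : E →+ ℝ) (ha : Measurable a) (hb : Measurable b)
    (ha0 : ∀ᵐ x ∂ν, 0 ≤ a x) (hb0 : ∀ᵐ x ∂ν, 0 ≤ b x) :
    ν.real {x | a x ≠ 0} * (ν.real {x | a x ≠ 0 ∨ b x ≠ 0} - ν.real {x | a x ≠ 0}) ≤
      ν.real {x | a x ≠ 0 ∧ b x ≠ 0} := by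
  have := hν.isProbabilityMeasure
  have h := hν.mul_le_measureReal a b ha hb ha0 hb0
  have hma : MeasurableSet {x | a x = 0} := ha (measurableSet_singleton 0)
  have hmb : MeasurableSet {x | b x = 0} := hb (measurableSet_singleton 0)
  have hab : MeasurableSet {x | a x = 0 ∧ b x = 0} := hma.inter hmb
  have e1 : ν.real {x | a x ≠ 0} = 1 - ν.real {x | a x = 0} := probReal_compl_eq_one_sub hma
  have e2 : ν.real {x | b x ≠ 0} = 1 - ν.real {x | b x = 0} := probReal_compl_eq_one_sub hmb
  have e3 : ν.real {x | a x ≠ 0 ∨ b x ≠ 0} = 1 - ν.real {x | a x = 0 ∧ b x = 0} := by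
    rw [← probReal_compl_eq_one_sub hab]
    congr 1
    ext x
    simp only [Set.mem_ofPred_eq, Set.mem_compl_iff]
    tauto
  have e4 := measureReal_union_add_inter (μ := ν) (s := {x | a x ≠ 0}) hmb.compl
  change ν.real {x | a x ≠ 0 ∨ b x ≠ 0} + ν.real {x | a x ≠ 0 ∧ b x ≠ 0} =
    ν.real {x | a x ≠ 0} + ν.real {x | b x ≠ 0} at e4
  have h1 : 0 ≤ ν.real {x | a x ≠ 0 ∧ b x ≠ 0} := measureReal_nonneg
  have h2 : 0 ≤ ν.real {x | a x ≠ 0} := measureReal_nonneg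
  have h3 := mul_nonneg h2 h1
  rw [show ν.real {x | a x = 0} = 1 - ν.real {x | a x ≠ 0} by linarith,
    show ν.real {x | b x = 0} = 1 - ν.real {x | b x ≠ 0} by linarith] at h
  rw [show ν.real {x | a x ≠ 0 ∨ b x ≠ 0} - ν.real {x | a x ≠ 0} =
    ν.real {x | b x ≠ 0} - ν.real {x | a x ≠ 0 ∧ b x ≠ 0} by linarith]
  linarith

/-- The renewal epochs, recovered from the counting function. -/
noncomputable def renewalEpoch (c : ℝ≥0 → ℕ) (n : ℕ) : ℝ :=
  (⨅ q : ℚ, if n ≤ c (q : ℝ).toNNReal then ENNReal.ofReal q else ⊤).toReal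

theorem measurable_renewalEpoch (n : ℕ) : Measurable fun c => renewalEpoch c n := by
  refine (Measurable.iInf fun q => Measurable.ite ?_ measurable_const
    measurable_const).ennreal_toReal
  exact measurableSet_le measurable_const (measurable_pi_apply _)

theorem renewalEpoch_eq {c : ℝ≥0 → ℕ} {n : ℕ} {x : ℝ} (hx : 0 ≤ x)
    (h : ∀ t : ℝ≥0, n ≤ c t ↔ x ≤ t) : renewalEpoch c n = x := by
  have : (⨅ q : ℚ, if n ≤ c (q : ℝ).toNNReal then ENNReal.ofReal q else ⊤) = ENNReal.ofReal x := by
    refine le_antisymm ?_ (le_iInf fun q => ?_)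
    · refine le_of_forall_gt_imp_ge_of_dense fun r hr => ?_
      rcases eq_or_ne r ⊤ with rfl | hrt
      · exact le_top
      rw [ENNReal.ofReal_lt_iff_lt_toReal hx hrt] at hr
      obtain ⟨q, hq1, hq2⟩ := exists_rat_btwn hr
      refine (iInf_le _ q).trans ?_
      rw [if_pos ((h _).2 (hq1.le.trans (Real.le_coe_toNNReal _)))]
      exact ENNReal.ofReal_le_of_le_toReal hq2.le
    · split_ifs with hq
      · rw [h, Real.coe_toNNReal'] at hq
        rcases le_max_iff.1 hq with hq | hq
        · exact ENNReal.ofReal_le_ofReal hq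
        · rw [le_antisymm hq hx, ENNReal.ofReal_zero]
          exact zero_le
      · exact le_top
  rw [renewalEpoch, this, ENNReal.toReal_ofReal hx]

theorem indepFun_waitingTimes {Ω β : Type*} [MeasurableSpace Ω] [MeasurableSpace β] {P : Measure Ω}
    {N : ℝ≥0 → Ω → ℕ} {W : ℕ → Ω → ℝ} {V : Ω → β}
    (hN : ∀ᵐ ω ∂P, ∀ (t : ℝ≥0) (n : ℕ), n ≤ N t ω ↔ ∑ i ∈ Finset.range n, W i ω ≤ (t : ℝ))
    (hW : ∀ᵐ ω ∂P, ∀ i, 0 ≤ W i ω) (hNV : IndepFun (fun ω t => N t ω) V P) :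
    IndepFun (fun ω i => W i ω) V P := by
  have hm : Measurable fun (c : ℝ≥0 → ℕ) (i : ℕ) => renewalEpoch c (i + 1) - renewalEpoch c i :=
    measurable_pi_lambda _ fun i =>
      (measurable_renewalEpoch (i + 1)).sub (measurable_renewalEpoch i)
  refine (hNV.comp hm measurable_id).congr ?_ .rfl
  filter_upwards [hN, hW] with ω h1 h2
  ext i
  have h3 : ∀ n, renewalEpoch (fun t => N t ω) n = ∑ i ∈ Finset.range n, W i ω := fun n =>
    renewalEpoch_eq (Finset.sum_nonneg fun i _ => h2 i) fun t => h1 t n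
  simp [h3, Finset.sum_range_succ]

namespace IsGFNBPPair

theorem exists_mul_le_sq {Ω : Type*} [MeasurableSpace Ω] {P : Measure Ω} [IsProbabilityMeasure P]
    {α β ρ μ lam : ℝ} (hβ₀ : 0 < β) (hβ₁ : β < 1) (hρ : 0 < ρ) (hμ : 0 < μ) (hlam : 0 < lam)
    {N : ℝ≥0 → Ω → ℕ} {M : ℝ≥0 → Ω → ℝ≥0} (h : IsGFNBPPair P α β ρ μ lam N M)
    (hdiv : IsInfinitelyDivisibleProcess P (timeChange N M)) :
    ∃ c > 0, ∃ V : Ω → ℝ, IsMittagLefflerLaw β lam (P.map V) ∧ Measurable V ∧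
      ∀ s : ℝ≥0, c * P.real {a | 2 ≤ (M s a : ℝ)} ≤ P.real {a | V a ≤ (M s a : ℝ)} ^ 2 := by
  obtain ⟨W, hW, hWind, hsurv, hN⟩ := h.poisson.renewal
  have hlaw : ∀ i, IsMittagLefflerLaw β lam (P.map (W i)) := fun i =>
    ⟨Measure.isProbabilityMeasure_map (hW i).aemeasurable, fun t ht => by
      rw [map_measureReal_apply (hW i) measurableSet_Ioi]
      exact hsurv i t ht⟩
  have hWlaw : ∀ i, P.map (W i) = P.map (W 0) := fun i => (hlaw i).eq (hlaw 0) hβ₀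
  have hWnonneg : ∀ᵐ a ∂P, ∀ i, 0 ≤ W i a := by
    rw [ae_all_iff]
    intro i
    have h1 := (hlaw i).measure_Iic_of_nonpos hβ₀ le_rfl
    rw [Measure.map_apply (hW i) measurableSet_Iic] at h1
    rw [← compl_mem_ae_iff] at h1
    filter_upwards [h1] with a ha
    exact (not_le.1 (show ¬ W i a ≤ 0 from ha)).le
  have hWM : IndepFun (fun a i => W i a) (fun a t => M t a) P :=
    indepFun_waitingTimes hN hWnonneg h.indep
  have hM := h.subordinator
  set q : ℝ → ENNReal := fun y => ENNReal.ofReal (1 - (y / (1 + y)) ^ (1 - β)) *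
    (P.map (W 0)) (Set.Iic y) with hq
  have hqm : Measurable q := by
    refine Measurable.mul ?_ (measurable_measure_Iic _)
    fun_prop
  set C : ENNReal := (P.map (W 0)) (Set.Iic 1) * ∫⁻ a, q (M 1 a : ℝ) ∂P with hC
  have hp0 := (hlaw 0).isProb
  have hq1 : ∀ y : ℝ, 0 ≤ y → q y ≤ 1 := by
    intro y hy
    have : (0 : ℝ) ≤ (y / (1 + y)) ^ (1 - β) := by positivity
    exact mul_le_one' (ENNReal.ofReal_le_one.2 (by linarith)) prob_le_one
  have hCtop : C ≠ ⊤ := by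
    refine ENNReal.mul_ne_top (measure_ne_top _ _) (ne_top_of_le_ne_top (ENNReal.one_ne_top) ?_)
    calc _ ≤ ∫⁻ a, 1 ∂P := lintegral_mono fun a => hq1 _ (M 1 a).coe_nonneg
      _ = 1 := by simp
  have hC0 : C ≠ 0 := by
    refine mul_ne_zero ((hlaw 0).measure_Iic_pos hβ₀ hβ₁ hlam one_pos).ne' fun h0 => ?_
    have hm1 := hM.measurable 1
    have h0 := (lintegral_eq_zero_iff (μ := P) (f := fun a => q (M 1 a))
      (hqm.comp (by fun_prop : Measurable fun a => (M 1 a : ℝ)))).1 h0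
    refine hM.measure_pos_ne_zero hρ hμ ?_
    rw [← compl_mem_ae_iff]
    filter_upwards [h0] with a ha hpos
    have hpos' : 0 < (M 1 a : ℝ) := hpos
    refine mul_ne_zero ?_ ((hlaw 0).measure_Iic_pos hβ₀ hβ₁ hlam hpos').ne' ha
    have : ((M 1 a : ℝ) / (1 + M 1 a)) ^ (1 - β) < 1 :=
      Real.rpow_lt_one (by positivity) ((div_lt_one (by positivity)).2 (by linarith)) (by linarith)
    exact (ENNReal.ofReal_pos.2 (by linarith)).ne'
  refine ⟨C.toReal, ENNReal.toReal_pos hC0 hCtop, W 0, hlaw 0, hW 0, fun s => ?_⟩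
  let X : Ω → ℝ := fun a => M s a
  let Y : Ω → ℝ := fun a => ((M (s + 1) a - M s a : ℝ≥0) : ℝ)
  have hMs := hM.measurable s
  have hMs1 := hM.measurable (s + 1)
  have hX : Measurable X := by fun_prop
  have hY : Measurable Y := by fun_prop
  have hXYsum : ∀ᵐ a ∂P, X a + Y a = M (s + 1) a := by
    filter_upwards [hM.mono] with a ha
    have : M s a ≤ M (s + 1) a := ha le_self_add
    simp only [X, Y]
    rw [← NNReal.coe_add, add_tsub_cancel_of_le this]
  have hXY : IndepFun X Y P := by
    have h1 : IndepFun (M s) (M (s + 1) - M s) P :=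
      (hM.indep.indepFun_sub_sub (zero_le (a := s)) (le_self_add (a := s) (b := 1))).congr
        (by filter_upwards [hM.start] with a ha using by simp [ha]) .rfl
    exact h1.comp measurable_coe_nnreal_real measurable_coe_nnreal_real
  have hXYW : IndepFun (fun a => (X a, Y a)) (fun a i => W i a) P :=
    hWM.symm.comp (φ := fun f : ℝ≥0 → ℝ≥0 => ((f s : ℝ), ((f (s + 1) - f s : ℝ≥0) : ℝ))) (ψ := id)
      (by fun_prop) measurable_id
  have hYlaw : ∫⁻ a, q (Y a) ∂P = ∫⁻ a, q (M 1 a : ℝ) ∂P :=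
    ((hM.stationary s 1).comp (hqm.comp measurable_coe_nnreal_real)).lintegral_eq
  have hmain := tsum_measure_last_renewal_add_le hβ₀ hβ₁ hlam (hlaw 0) hW hWind hWlaw hX hY hXY hXYW
  change _ + _ * (_ * ∫⁻ a, q (Y a) ∂P) ≤ _ at hmain
  rw [hYlaw, ← hC] at hmain
  let I : Finset ℝ≥0 := {s, s + 1}
  let i₀ : I := ⟨s, by simp [I]⟩
  let i₁ : I := ⟨s + 1, by simp [I]⟩
  let F : Ω → I → ℝ := fun a i => timeChange N M i a
  have hI : IsInfinitelyDivisible (P.map F) := hdiv I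
  have hF : AEMeasurable F P := by
    have := hI.isProbabilityMeasure
    exact AEMeasurable.of_map_ne_zero (IsProbabilityMeasure.ne_zero _)
  let A : (I → ℝ) →+ ℝ := Pi.evalAddMonoidHom (fun _ => ℝ) i₀
  let B : (I → ℝ) →+ ℝ := Pi.evalAddMonoidHom (fun _ => ℝ) i₁ - Pi.evalAddMonoidHom (fun _ => ℝ) i₀
  have hA : Measurable A := measurable_pi_apply i₀
  have hB : Measurable B := (measurable_pi_apply i₁).sub (measurable_pi_apply i₀)
  have hNmono : ∀ᵐ a ∂P, N (M s a) a ≤ N (M (s + 1) a) a := by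
    filter_upwards [hM.mono, hN] with a ha hNa
    rw [hNa]
    refine ((hNa _ _).1 le_rfl).trans ?_
    exact_mod_cast ha le_self_add
  have hA0 : ∀ᵐ x ∂(P.map F), 0 ≤ A x := by
    rw [ae_map_iff hF (measurableSet_le measurable_const hA)]
    exact Filter.Eventually.of_forall fun a => Nat.cast_nonneg _
  have hB0 : ∀ᵐ x ∂(P.map F), 0 ≤ B x := by
    rw [ae_map_iff hF (measurableSet_le measurable_const hB)]
    filter_upwards [hNmono] with a ha
    exact sub_nonneg.2 (Nat.cast_le.2 ha)
  have hkey := hI.mul_sub_le_measureReal A B hA hB hA0 hB0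
  have hmA : MeasurableSet {x | A x ≠ 0} := (hA (measurableSet_singleton 0)).compl
  have hmB : MeasurableSet {x | B x ≠ 0} := (hB (measurableSet_singleton 0)).compl
  have hmAoB : MeasurableSet {x | A x ≠ 0 ∨ B x ≠ 0} := hmA.union hmB
  have hmAaB : MeasurableSet {x | A x ≠ 0 ∧ B x ≠ 0} := hmA.inter hmB
  have hAF : ∀ a, A (F a) ≠ 0 ↔ 1 ≤ N (M s a) a := fun a => by
    change ((N (M s a) a : ℝ) ≠ 0) ↔ _
    rw [Nat.cast_ne_zero, Nat.one_le_iff_ne_zero]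
  have hBF : ∀ a, N (M s a) a ≤ N (M (s + 1) a) a →
      (B (F a) ≠ 0 ↔ N (M s a) a < N (M (s + 1) a) a) := fun a ha => by
    change ((N (M (s + 1) a) a : ℝ) - (N (M s a) a : ℝ) ≠ 0) ↔ _
    rw [sub_ne_zero, Nat.cast_inj.ne]
    omega
  have e1 : (P.map F).real {x | A x ≠ 0} = P.real {a | W 0 a ≤ X a} := by
    rw [measureReal_def, Measure.map_apply_of_aemeasurable hF hmA]
    refine congrArg ENNReal.toReal (measure_congr ?_)
    filter_upwards [hN] with a hNa
    refine propext ((hAF a).trans ((hNa _ 1).trans ?_))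
    rw [Finset.sum_range_one]
    rfl
  have e2 : P.real {a | W 0 a ≤ Y a} ≤ (P.map F).real {x | A x ≠ 0 ∨ B x ≠ 0} := by
    rw [measureReal_def, measureReal_def, Measure.map_apply_of_aemeasurable hF hmAoB]
    refine ENNReal.toReal_mono (measure_ne_top _ _) (measure_mono_ae ?_)
    filter_upwards [hN, hNmono, hXYsum] with a hNa hmono hsum hle
    have hle' : W 0 a ≤ Y a := hle
    have h1 : 1 ≤ N (M (s + 1) a) a := by
      rw [hNa, Finset.sum_range_one, ← hsum]
      have : 0 ≤ X a := (M s a).coe_nonneg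
      linarith
    change A (F a) ≠ 0 ∨ B (F a) ≠ 0
    rw [hAF, hBF a hmono]
    omega
  have e3 : (P.map F) {x | A x ≠ 0 ∧ B x ≠ 0} ≤ ∑' m : ℕ, P {a | W 0 a ≤ X a ∧
      X a < W 0 a + ∑ i ∈ Finset.range (m + 1), W (i + 1) a ∧
      W 0 a + ∑ i ∈ Finset.range (m + 1), W (i + 1) a ≤ X a + Y a ∧
      X a + Y a < W 0 a + ∑ i ∈ Finset.range (m + 1), W (i + 1) a + W (m + 2) a} := by
    rw [Measure.map_apply_of_aemeasurable hF hmAaB]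
    refine le_trans (measure_mono_ae ?_) (measure_iUnion_le _)
    filter_upwards [hN, hNmono, hXYsum] with a hNa hmono hsum hmem
    have hmem' : A (F a) ≠ 0 ∧ B (F a) ≠ 0 := hmem
    rw [hAF, hBF a hmono] at hmem'
    obtain ⟨m, hm⟩ : ∃ m, N (M (s + 1) a) a = m + 2 := ⟨N (M (s + 1) a) a - 2, by omega⟩
    have hS : ∑ i ∈ Finset.range (m + 2), W i a =
        W 0 a + ∑ i ∈ Finset.range (m + 1), W (i + 1) a := by
      rw [Finset.sum_range_succ', add_comm]
    refine Set.mem_iUnion.2 ⟨m, ?_, ?_, ?_, ?_⟩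
    · have := (hNa _ 1).1 hmem'.1
      rwa [Finset.sum_range_one] at this
    · rw [← hS]
      have := (hNa (M s a) (m + 2)).not.1 (by omega)
      exact not_le.1 this
    · rw [← hS, hsum, ← hNa, hm]
    · rw [← hS, hsum, ← Finset.sum_range_succ]
      have := (hNa (M (s + 1) a) (m + 2 + 1)).not.1 (by omega)
      exact not_le.1 this
  clear_value C
  have hfin := (add_le_add_left e3 _).trans hmain
  have hfin' := ENNReal.toReal_mono (ENNReal.mul_ne_top (measure_ne_top _ _) (measure_ne_top _ _)) hfin
  have := hI.isProbabilityMeasure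
  rw [ENNReal.toReal_add (measure_ne_top _ _) (ENNReal.mul_ne_top (measure_ne_top _ _) hCtop),
    ENNReal.toReal_mul, ENNReal.toReal_mul] at hfin'
  simp only [← measureReal_def] at hfin'
  rw [e1] at hkey
  have hXnonneg : 0 ≤ P.real {a | W 0 a ≤ X a} := measureReal_nonneg
  have h5 := mul_le_mul_of_nonneg_left e2 hXnonneg
  change C.toReal * P.real {a | 2 ≤ X a} ≤ P.real {a | W 0 a ≤ X a} ^ 2
  nlinarith

end IsGFNBPPair

theorem theorem2 {Ω : Type*} [MeasurableSpace Ω] (P : Measure Ω) [IsProbabilityMeasure P]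
    (α β ρ μ lam : ℝ) (hα₀ : 0 < α) (hα₁ : α < 1) (hβ₀ : 0 < β) (hβ₁ : β < 1)
    (hρ : 0 < ρ) (hμ : 0 < μ) (hlam : 0 < lam)
    (N : ℝ≥0 → Ω → ℕ) (M : ℝ≥0 → Ω → ℝ≥0) (h : IsGFNBPPair P α β ρ μ lam N M) :
    ¬ IsInfinitelyDivisibleProcess P (timeChange N M) := by
  intro hdiv
  obtain ⟨c, hc, V, hV, hVm, hcV⟩ := h.exists_mul_le_sq hβ₀ hβ₁ hρ hμ hlam hdiv
  have hM := h.subordinator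
  obtain ⟨d, hd, s₀, hs₀, hds⟩ := hM.exists_mul_le_measureReal hα₀ hα₁ hρ hμ
  obtain ⟨K, hK⟩ := hM.exists_measureReal_le_rpow hα₀ hρ hμ hβ₀
  have := hV.isProb
  have hΓ := Real.Gamma_pos_of_pos (show 0 < β + 1 by linarith)
  have hG : ∀ s : ℝ≥0, 0 < s → s ≤ 1 → P.real {a | V a ≤ (M s a : ℝ)} ≤
      (K + lam / Real.Gamma (β + 1)) * (s : ℝ) ^ (3 / 4 : ℝ) := by
    intro s hs hs1
    have hs0 : (0 : ℝ) < s := hs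
    have hε : 0 < (s : ℝ) ^ β⁻¹ := Real.rpow_pos_of_pos hs0 _
    have h1 : P.real {a | V a ≤ (s : ℝ) ^ β⁻¹} ≤ lam / Real.Gamma (β + 1) * s := by
      have h2 := hV.measure_Iic_le hβ₀ hβ₁ hlam hε.le
      rw [← Real.rpow_mul hs0.le, inv_mul_cancel₀ hβ₀.ne', Real.rpow_one,
        Measure.map_apply hVm measurableSet_Iic] at h2
      exact ENNReal.toReal_le_of_le_ofReal (by positivity) h2
    have h2 : (s : ℝ) ≤ (s : ℝ) ^ (3 / 4 : ℝ) := by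
      nth_rw 1 [← Real.rpow_one (s : ℝ)]
      exact Real.rpow_le_rpow_of_exponent_ge hs0 hs1 (by norm_num)
    have h3 : {a | V a ≤ (M s a : ℝ)} ⊆
        {a | (s : ℝ) ^ β⁻¹ ≤ (M s a : ℝ)} ∪ {a | V a ≤ (s : ℝ) ^ β⁻¹} := by
      intro a ha
      rcases le_total ((s : ℝ) ^ β⁻¹) (M s a : ℝ) with h4 | h4
      · exact Or.inl h4
      · exact Or.inr (le_trans ha h4)
    calc _ ≤ _ := measureReal_mono h3
      _ ≤ _ := measureReal_union_le _ _
      _ ≤ K * (s : ℝ) ^ (3 / 4 : ℝ) + lam / Real.Gamma (β + 1) * s := add_le_add (hK s hs hs1) h1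
      _ ≤ K * (s : ℝ) ^ (3 / 4 : ℝ) + lam / Real.Gamma (β + 1) * (s : ℝ) ^ (3 / 4 : ℝ) := by gcongr
      _ = _ := by ring
  set L := K + lam / Real.Gamma (β + 1)
  have hbound : ∀ s : ℝ, 0 < s → s ≤ 1 → s ≤ s₀ → c * d ≤ L ^ 2 * s ^ (1 / 2 : ℝ) := by
    intro s hs hs1 hs2
    let t : ℝ≥0 := ⟨s, hs.le⟩
    have h1 := hG t hs hs1
    have h2 := hds t hs2
    have h3 := hcV t
    have h4 : P.real {a | V a ≤ (M t a : ℝ)} ^ 2 ≤ (L * s ^ (3 / 4 : ℝ)) ^ 2 :=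
      pow_le_pow_left₀ measureReal_nonneg h1 2
    have h5 : c * (d * s) ≤ (L * s ^ (3 / 4 : ℝ)) ^ 2 :=
      (mul_le_mul_of_nonneg_left h2 hc.le).trans (h3.trans h4)
    have h6 : (s ^ (3 / 4 : ℝ)) ^ 2 = s ^ (1 / 2 : ℝ) * s := by
      rw [← Real.rpow_natCast, ← Real.rpow_mul hs.le]
      nth_rw 3 [← Real.rpow_one s]
      rw [← Real.rpow_add hs]
      norm_num
    rw [mul_pow, h6, ← mul_assoc, ← mul_assoc] at h5
    exact le_of_mul_le_mul_right h5 hs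
  have hlim : Filter.Tendsto (fun s : ℝ => L ^ 2 * s ^ (1 / 2 : ℝ)) (nhdsWithin 0 (Set.Ioi 0))
      (nhds 0) := by
    have h1 := (Real.continuousAt_rpow_const 0 (1 / 2 : ℝ) (Or.inr (by norm_num))).tendsto
    rw [Real.zero_rpow (by norm_num)] at h1
    simpa using (h1.mono_left nhdsWithin_le_nhds).const_mul (L ^ 2)
  have hev : ∀ᶠ s : ℝ in nhdsWithin 0 (Set.Ioi 0), s ∈ Set.Ioc 0 (min 1 s₀) :=
    Ioc_mem_nhdsGT (lt_min one_pos hs₀)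
  have hle : c * d ≤ 0 := ge_of_tendsto hlim (by
    filter_upwards [hev] with s hs
    exact hbound s hs.1 (hs.2.trans (min_le_left _ _)) (hs.2.trans (min_le_right _ _)))
  have : 0 < c * d := by positivity
  linarith
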